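/- **Sketches.** A sketch $A$ has a countable state space $\mathcal M$ and an induced distribution family $\psi_\lambda$ ($\lambda>0$), where $\psi_\lambda(x)$ is the probability of being in state $x\in\mathcal M$ at (Poissonized) cardinality $\lambda$. Write $$H_A(\lambda)=\sum_{x}-\psi_\lambda(x)\log_2\psi_\lambda(x),\qquad I_A(\lambda)=\sum_{x:\,\psi_\lambda(x)>0}\Big(\frac{\frac{d}{d\lambda}\psi_\lambda(x)}{\psi_\lambda(x)}\Big)^2\psi_\lambda(x)$$ for the Shannon entropy of the state and the Fisher information of $\lambda$ with respect to the state; both lie in $[0,\infty]$ (a derivative that does not exist is read as $0$). For $q>1$, $A$ is *weakly scale-invariant with base $q$* if $H_A(\lambda)=H_A(q\lambda)$ and $I_A(\lambda)=q^2I_A(q\lambda)$ for all $\lambda>0$. Its *Fish number* is then $$\mathsf{Fish}(A)=\frac{\mathcal H(A)}{\mathcal I(A)},\qquad \mathcal H(A)=\int_0^1H_A(q^r)\,dr,\qquad \mathcal I(A)=\int_0^1q^{2r}I_A(q^r)\,dr,$$ an element of $[0,\infty]$, which is well defined unless the quotient reads $0/0$ or $\infty/\infty$. **Linearizable sketches.**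 Consider a countable, linearly ordered set $\mathcal C$ of cells with sizes $p_c\ge 0$. At time $\lambda$ the numbers of darts in the cells are independent Poisson variables with means $p_c\lambda$; let $Z_c\in\{0,1\}$ indicate that $c$ contains a dart. For each $c$ let $\phi_c$ be a monotone $\{0,1\}$-valued function of the set of occupied cells preceding $c$. The set of occupied cells, with indicators $Y_c$, is given by $$Y_c=Z_c\vee\phi_c\big((Y_{c'})_{c'<c}\big)\qquad(c\in\mathcal C);$$ if the order of the cells is not a well-order, so that this recursion may have several solutions, $Y$ is its least solution. The map from dart counts to $Y$ is assumed measurable. A sketch is *linearizable* if, for some such data, its states can be identified injectively with sets of occupied cells in such a way that $\psi_\lambda$ is the distribution of $Y$ at time $\lambda$, for every $\lambda>0$. (The total size of the cells may be infinite: a sketch that is exactly scale-invariant and not constant needs infinitely many arbitrarily large and arbitrarily small cells.) **Statement.** Let $h(x)=-x\ln x-(1-x)\ln(1-x)$ and $$H_0=\frac1{\ln 2}\int_{-\infty}^{\infty}h\big(e^{-e^w}\big)\,dw,\qquad I_0=\int_{-\infty}^{\infty}\frac{e^{2w}}{e^{e^w}-1}\,dw .$$ Let $q>1$ and let $A$ be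 a linearizable sketch that is weakly scale-invariant with base $q$ and whose Fish number is well defined, i.e. $\mathcal H(A),\mathcal I(A)$ are neither both $0$ nor both $\infty$. Then $$\mathsf{Fish}(A)\ \ge\ \frac{H_0}{I_0}.$$ -/

import Mathlib

open MeasureTheory ProbabilityTheory
open scoped ENNReal NNReal

noncomputable section

/-! ### Sketches as parameterized families of distributions -/

/-- The induced distribution family of a sketch with state space `M`: `prob t x` is the probability
that the sketch is in state `x` at cardinality `t > 0`.  (Values at `t ≤ 0` are irrelevant.) -/
structure SketchIDF (M : Type*) where
  prob : ℝ → M → ℝ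
  prob_nonneg : ∀ t, 0 < t → ∀ x, 0 ≤ prob t x
  prob_hasSum : ∀ t, 0 < t → HasSum (prob t) 1

namespace SketchIDF

variable {M : Type*}

/-- Shannon entropy, in bits, of the state at cardinality `t`. -/
def entropy (A : SketchIDF M) (t : ℝ) : ℝ≥0∞ :=
  ∑' x, ENNReal.ofReal (-(A.prob t x) * Real.logb 2 (A.prob t x))

/-- Fisher information of the cardinality with respect to the state, at cardinality `t`: the
expected square of the logarithmic derivative of the probability.  States of probability zero
contribute nothing to the expectation. -/
def fisherInfo (A : SketchIDF M) (t : ℝ) : ℝ≥0∞ :=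
  ∑' x, ENNReal.ofReal ((deriv (fun s => A.prob s x) t / A.prob t x) ^ 2 * A.prob t x)

/-- Weak scale-invariance with base `q`. -/
def WeaklyScaleInvariant (A : SketchIDF M) (q : ℝ) : Prop :=
  1 < q ∧ ∀ t : ℝ, 0 < t →
    A.entropy t = A.entropy (q * t) ∧
    A.fisherInfo t = ENNReal.ofReal (q ^ 2) * A.fisherInfo (q * t)

/-- Entropy averaged over one multiplicative period. -/
def avgEntropy (A : SketchIDF M) (q : ℝ) : ℝ≥0∞ :=
  ∫⁻ r in Set.Icc (0 : ℝ) 1, A.entropy (q ^ r)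

/-- Normalized Fisher information averaged over one multiplicative period. -/
def avgInfo (A : SketchIDF M) (q : ℝ) : ℝ≥0∞ :=
  ∫⁻ r in Set.Icc (0 : ℝ) 1, ENNReal.ofReal (q ^ (2 * r)) * A.fisherInfo (q ^ r)

/-- The Fisher–Shannon number of a sketch that is weakly scale-invariant with base `q`.
It is meaningful unless the quotient reads `0 / 0` or `∞ / ∞`. -/
def fish (A : SketchIDF M) (q : ℝ) : ℝ≥0∞ :=
  A.avgEntropy q / A.avgInfo q

end SketchIDF

/-! ### The Poissonized dartboard and linearizable sketches -/

/-- A dartboard with a linearly ordered set `C` of cells, and a linear update rule on it.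
`size c` is the rate at which darts hit `c`.  `force c σ` is the monotone function `φ` of the
occupied cells preceding `c`; it is only ever evaluated at subsets of `Set.Iio c`.
If it is true, then `c` is occupied whether or not it has been hit. -/
structure LinearRule (C : Type*) [LinearOrder C] where
  size : C → ℝ≥0
  force : C → Set C → Prop
  force_mono : ∀ c σ τ, σ ⊆ τ → force c σ → force c τ

namespace LinearRule

variable {C : Type*} [LinearOrder C]

/-- The cells that are hit, or forced by the cells of `σ` preceding them. -/
def step (R : LinearRule C) (hit : Set C) : Set C →o Set C where
  toFun σ := hit ∪ {c | R.force c (σ ∩ Set.Iio c)}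
  monotone' _ _ h := Set.union_subset_union_right _ fun c hc =>
    R.force_mono c _ _ (Set.inter_subset_inter_left _ h) hc

/-- The set of occupied cells once the cells of `hit` have been hit: the least `σ` such that a cell
belongs to `σ` iff it is hit, or forced by the cells of `σ` preceding it.  (Leastness matters only
if the order of the cells is not a well-order, see `eq_state`: no cell is occupied without cause.) -/
def state (R : LinearRule C) (hit : Set C) : Set C :=
  OrderHom.lfp (R.step hit)

/-- The defining recursion `Yᵢ = Zᵢ ∨ φ(Y₀, …, Yᵢ₋₁)`. -/
theorem mem_state_iff (R : LinearRule C) (hit : Set C) (c : C) :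
    c ∈ R.state hit ↔ c ∈ hit ∨ R.force c (R.state hit ∩ Set.Iio c) := by
  have h : R.step hit (R.state hit) = R.state hit := OrderHom.map_lfp _
  exact (Set.ext_iff.1 h c).symm

/-- For well-ordered cells the recursion alone determines the state. -/
theorem eq_state [WellFoundedLT C] (R : LinearRule C) (hit σ : Set C)
    (h : ∀ c, c ∈ σ ↔ c ∈ hit ∨ R.force c (σ ∩ Set.Iio c)) : σ = R.state hit := by
  ext c
  induction c using WellFoundedLT.induction with
  | ind c ih =>
    have e : σ ∩ Set.Iio c = R.state hit ∩ Set.Iio c := by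
      ext d
      exact and_congr_left fun hd => ih d hd
    rw [h, R.mem_state_iff, e]

/-- The joint law, at time `t`, of the numbers of darts in the cells: independent Poisson variables
with means `size c * t`. -/
def dartLaw (R : LinearRule C) (t : ℝ) : Measure (C → ℕ) :=
  Measure.infinitePi fun c => poissonMeasure (R.size c * t.toNNReal)

/-- The state of the sketch as a function of the numbers of darts in the cells. -/
def stateOf (R : LinearRule C) (darts : C → ℕ) : Set C :=
  R.state {c | darts c ≠ 0}

end LinearRule

/-- A sketch is linearizable if its states can be identified with sets of occupied cells of a
dartboard with countably many linearly ordered cells, such that the random set of occupied cells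
is produced by a linear rule from the darts thrown up to time `t`. -/
def SketchIDF.Linearizable {M : Type*} (A : SketchIDF M) : Prop :=
  ∃ (C : Type) (_ : Countable C) (_ : LinearOrder C) (R : LinearRule C) (occ : M → Set C),
    Function.Injective occ ∧ Measurable R.stateOf ∧
    ∀ t : ℝ, 0 < t → ∀ x, A.prob t x = (R.dartLaw t).real {darts | R.stateOf darts = occ x}

/-! ### The constants -/

/-- Entropy in nats of a Bernoulli variable. -/
def bernoulliEntropy (x : ℝ) : ℝ := -x * Real.log x - (1 - x) * Real.log (1 - x)

/-- The constant `H₀`. -/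
def constH0 : ℝ := 1 / Real.log 2 * ∫ w : ℝ, bernoulliEntropy (Real.exp (-Real.exp w))

/-- The constant `I₀`. -/
def constI0 : ℝ := ∫ w : ℝ, Real.exp w ^ 2 / (Real.exp (Real.exp w) - 1)

end

/-! A state `σ` requires each cell to be empty (outside `σ`), hit (in `σ` and not forced), or
arbitrary (forced). These requirements concern different cells, hence are independent. What remains
is whether the hits really generate `σ`; finitely many cells do not affect this, so by Kolmogorov's
law it has probability 0 or 1. The probability of a state is therefore 0 or a product over cells
(`prob_eq_of_pos`), and its surprisal and score are sums over cells.

The darts in a cell are independent of the cells occupied before it. With `P c t` the probability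
that `c` is not forced and `x = p_c t`, the mean surprisals give `H ≥ ∑ P c t * h(e^{-x}) / ln 2`
(`tsum_freeProb_le_entropy`). The scores are martingale differences, hence orthogonal, and Fatou's
lemma gives `t² I ≤ ∑ P c t * x² / (e^x - 1)` (`fisherInfo_le_tsum_freeProb`).

Two monotonicities finish the proof. More darts force more cells, so `P c t` is nonincreasing in `t`
(`freeProb_anti`). The ratio of `h(e^{-x})` to `x² / (e^x - 1)` is nonincreasing in `x`
(`entropyRatio_anti`). On a logarithmic time axis a nonincreasing weight favours small `x`, where
this ratio is large, so a Chebyshev-type inequality shows that each cell, integrated over time, has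
entropy at least `H₀ / I₀` times its information, up to a boundary term at the left end of the time
window (`totalRatio_mul_integral_le`). That term is at most a constant times the entropy of the cell
at the left end. Averaging the end over one period, summing over cells and using scale invariance
over `n` periods leaves an error of boundedly many periods of entropy, which vanishes relative to
`n`. -/

namespace LinearRule

/-! ### Least fixed points: how the hits determine the state -/

section Deterministic

variable {C : Type*} [LinearOrder C] (R : LinearRule C)

theorem state_subset {hit σ : Set C} (h1 : hit ⊆ σ)
    (h2 : ∀ c, R.force c (σ ∩ Set.Iio c) → c ∈ σ) : R.state hit ⊆ σ :=
  OrderHom.lfp_le _ (Set.union_subset h1 h2)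

theorem subset_state (hit : Set C) : hit ⊆ R.state hit :=
  fun c hc => (R.mem_state_iff hit c).2 (Or.inl hc)

theorem mem_state_of_force {hit : Set C} {c : C} (h : R.force c (R.state hit ∩ Set.Iio c)) :
    c ∈ R.state hit :=
  (R.mem_state_iff hit c).2 (Or.inr h)

theorem state_mono {hit hit' : Set C} (h : hit ⊆ hit') : R.state hit ⊆ R.state hit' :=
  R.state_subset (h.trans (R.subset_state hit')) fun _ => R.mem_state_of_force

/-- Occupation of the cells before `c` depends only on the hits before `c`. -/
theorem state_inter_Iio (hit : Set C) (c : C) :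
    R.state (hit ∩ Set.Iio c) ∩ Set.Iio c = R.state hit ∩ Set.Iio c := by
  apply Set.Subset.antisymm
  · exact Set.inter_subset_inter_left _ (R.state_mono Set.inter_subset_left)
  · have h : R.state hit ⊆ R.state (hit ∩ Set.Iio c) ∪ Set.Ici c := by
      apply R.state_subset
      · intro d hd
        rcases lt_or_ge d c with h | h
        · exact Or.inl (R.subset_state _ ⟨hd, h⟩)
        · exact Or.inr h
      · intro d hd
        rcases lt_or_ge d c with h | h
        · refine Or.inl (R.mem_state_of_force (R.force_mono _ _ _ ?_ hd))
          rintro e ⟨he | he, hed⟩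
          · exact ⟨he, hed⟩
          · exact absurd (lt_of_le_of_lt he (lt_trans hed h)) (lt_irrefl _)
        · exact Or.inr h
    rintro d ⟨hd, hdc⟩
    exact ⟨(h hd).resolve_right (not_le.2 hdc), hdc⟩

/-- Removing the hit of a cell that is forced anyway does not change the state. -/
theorem state_diff_singleton {hit : Set C} {c : C} (h : R.force c (R.state hit ∩ Set.Iio c)) :
    R.state (hit \ {c}) = R.state hit := by
  have e : (hit \ {c}) ∩ Set.Iio c = hit ∩ Set.Iio c := by
    ext d
    constructor
    · rintro ⟨⟨h1, _⟩, h2⟩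
      exact ⟨h1, h2⟩
    · rintro ⟨h1, h2⟩
      exact ⟨⟨h1, ne_of_lt h2⟩, h2⟩
  apply Set.Subset.antisymm (R.state_mono Set.sdiff_subset)
  apply R.state_subset
  · intro d hd
    by_cases hdc : d = c
    · subst hdc
      apply R.mem_state_of_force
      rwa [← R.state_inter_Iio, e, R.state_inter_Iio]
    · exact R.subset_state _ ⟨hd, hdc⟩
  · exact fun _ => R.mem_state_of_force

/-- The cells of `σ` that are not forced by the preceding cells of `σ`. -/
def essential (σ : Set C) : Set C := {c | c ∈ σ ∧ ¬ R.force c (σ ∩ Set.Iio c)}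

theorem essential_subset (σ : Set C) : R.essential σ ⊆ σ := fun _ h => h.1

/-- The first condition restricts each cell separately. The second keeps only hits inside `σ` and
adds all essential ones, so that it depends on the hits of inessential cells alone; this makes it a
tail condition by `state_diff_finite`. -/
theorem state_eq_iff (hit σ : Set C) :
    R.state hit = σ ↔
      (R.essential σ ⊆ hit ∧ hit ⊆ σ) ∧ R.state (hit ∩ σ ∪ R.essential σ) = σ := by
  have key : R.essential σ ⊆ hit → hit ⊆ σ → hit ∩ σ ∪ R.essential σ = hit := by
    intro h1 h2
    rw [Set.inter_eq_left.2 h2, Set.union_eq_left.2 h1]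
  constructor
  · intro h
    have h2 : hit ⊆ σ := h ▸ R.subset_state hit
    have h1 : R.essential σ ⊆ hit := by
      rintro c ⟨hc, hf⟩
      rw [← h] at hc hf
      exact ((R.mem_state_iff hit c).1 hc).resolve_right hf
    exact ⟨⟨h1, h2⟩, by rw [key h1 h2, h]⟩
  · rintro ⟨⟨h1, h2⟩, h⟩
    rwa [key h1 h2] at h

/-- Whether the hits of the inessential cells suffice for the state `σ` is not affected by finitely
many of them. -/
theorem state_diff_finite (hit σ : Set C) {F : Set C} (hF : F.Finite) :
    R.state ((hit \ F) ∩ σ ∪ R.essential σ) = σ ↔ R.state (hit ∩ σ ∪ R.essential σ) = σ := by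
  induction F, hF using Set.Finite.induction_on with
  | empty => simp
  | @insert a F ha hF ih =>
    rw [← ih]
    set h := (hit \ F) ∩ σ ∪ R.essential σ with hh
    -- Only an inessential cell of `σ` matters: any other `a` is either discarded by the
    -- intersection with `σ` or put back by the union with `R.essential σ`.
    by_cases hc : a ∈ σ ∧ R.force a (σ ∩ Set.Iio a)
    · have e : (hit \ insert a F) ∩ σ ∪ R.essential σ = h \ {a} := by
        ext d
        have : d = a → ¬ d ∈ R.essential σ := by
          rintro rfl h
          exact h.2 hc.2
        simp only [hh, Set.mem_union, Set.mem_inter_iff, Set.mem_sdiff, Set.mem_insert_iff,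
          Set.mem_singleton_iff]
        tauto
      rw [e]
      have hsub : h ⊆ σ := Set.union_subset Set.inter_subset_right (R.essential_subset σ)
      constructor
      · intro hs
        apply Set.Subset.antisymm
        · apply R.state_subset hsub
          intro d hd
          rw [← hs] at hd ⊢
          exact R.mem_state_of_force hd
        · calc σ = R.state (h \ {a}) := hs.symm
            _ ⊆ R.state h := R.state_mono Set.sdiff_subset
      · intro hs
        rw [R.state_diff_singleton (by rw [hs]; exact hc.2), hs]
    · have e : (hit \ insert a F) ∩ σ ∪ R.essential σ = h := by
        ext d
        have : d = a → d ∈ σ → d ∈ R.essential σ := by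
          rintro rfl h
          exact ⟨h, fun h' => hc ⟨h, h'⟩⟩
        simp only [hh, Set.mem_union, Set.mem_inter_iff, Set.mem_sdiff, Set.mem_insert_iff]
        tauto
      rw [e]

end Deterministic
end LinearRule

/-! ### The probability of a state: zero, or a product over cells -/

namespace LinearRule

section Probability

variable {C : Type*}

/-- The σ-algebra generated by the numbers of darts in the cells of `S`. -/
abbrev coordSigma (S : Set C) : MeasurableSpace (C → ℕ) :=
  ⨆ c ∈ S, MeasurableSpace.comap (fun ω : C → ℕ => ω c) inferInstance

theorem comap_eval_le (c : C) :
    MeasurableSpace.comap (fun ω : C → ℕ => ω c) inferInstance ≤ MeasurableSpace.pi :=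
  (measurable_pi_apply c).comap_le

theorem measurable_coordSigma {S : Set C} {c : C} (hc : c ∈ S) :
    Measurable[coordSigma S] (fun ω : C → ℕ => ω c) :=
  Measurable.mono (comap_measurable _)
    (le_iSup₂ (f := fun c (_ : c ∈ S) =>
      MeasurableSpace.comap (fun ω : C → ℕ => ω c) inferInstance) c hc) le_rfl

theorem measurable_coordSigma_pi {S : Set C} {Φ : (C → ℕ) → C → ℕ}
    (h : ∀ c, (∃ k, ∀ ω, Φ ω c = k) ∨ (c ∈ S ∧ ∀ ω, Φ ω c = ω c)) :
    Measurable[coordSigma S] Φ := by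
  refine @measurable_pi_lambda _ _ _ (coordSigma S) _ Φ fun c => ?_
  rcases h c with ⟨k, hk⟩ | ⟨hc, h⟩
  · simp only [hk]
    exact @measurable_const _ _ _ (coordSigma S) k
  · simp only [h]
    exact measurable_coordSigma hc

variable [LinearOrder C] (R : LinearRule C)

instance (t : ℝ) : IsProbabilityMeasure (R.dartLaw t) := by
  unfold dartLaw
  infer_instance

theorem iIndep_coord (t : ℝ) :
    iIndep (fun c => MeasurableSpace.comap (fun ω : C → ℕ => ω c) inferInstance) (R.dartLaw t) :=
  iIndepFun_infinitePi (X := fun _ n => n) fun _ => measurable_id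

theorem indep_coordSigma (t : ℝ) {S T : Set C} (h : Disjoint S T) :
    Indep (coordSigma S) (coordSigma T) (R.dartLaw t) :=
  indep_iSup_of_disjoint comap_eval_le (R.iIndep_coord t) h

theorem zero_or_one_of_tail (t : ℝ) {W : Set (C → ℕ)}
    (h : ∀ F : Set C, F.Finite → MeasurableSet[coordSigma Fᶜ] W) :
    R.dartLaw t W = 0 ∨ R.dartLaw t W = 1 := by
  refine measure_zero_or_one_of_measurableSet_limsup (f := Filter.cofinite) (p := Set.Finite)
    (ns := fun F : Finset C => (F : Set C)) comap_eval_le (R.iIndep_coord t)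
    (fun s hs => hs.compl_mem_cofinite) ?_ (fun F => F.finite_toSet)
    (fun c => ⟨{c}, by simp⟩) ?_
  · classical
    exact directed_of_isDirected_le fun a b h => Finset.coe_subset.2 h
  -- A σ-algebra competing in the limsup contains all but finitely many coordinate σ-algebras; the
  -- hypothesis is applied to the finite exceptional set.
  · rw [Filter.limsup_eq, MeasurableSpace.measurableSet_sInf]
    intro m hm
    have := h _ hm
    refine (?_ : coordSigma _ ≤ m) _ this
    refine iSup₂_le fun c hc => ?_
    simpa using hc

open Classical in
/-- The factor contributed by the cell `c` to a product over the cells of the state `σ`: `a` if the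
cell is empty, `e` if it is forced, and `b` if it is occupied without being forced. -/
noncomputable def cellVal {α : Type*} (a b e : α) (c : C) (σ : Set C) : α :=
  if c ∈ σ then (if R.force c (σ ∩ Set.Iio c) then e else b) else a

theorem apply_cellVal {α β : Type*} (f : α → β) (a b e : α) (c : C) (σ : Set C) :
    f (R.cellVal a b e c σ) = R.cellVal (f a) (f b) (f e) c σ := by
  unfold cellVal
  split_ifs <;> rfl

/-- The numbers of darts that occur in the cell `c` when the state is `σ`. -/
noncomputable def dartBox (σ : Set C) (c : C) : Set ℕ := R.cellVal {0} {0}ᶜ Set.univ c σ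

theorem mem_pi_dartBox_iff (σ : Set C) (ω : C → ℕ) :
    ω ∈ Set.univ.pi (R.dartBox σ) ↔
      R.essential σ ⊆ {c | ω c ≠ 0} ∧ {c | ω c ≠ 0} ⊆ σ := by
  simp only [Set.mem_pi, Set.mem_univ, true_implies, dartBox, cellVal, Set.subset_def, essential,
    Set.mem_ofPred_eq]
  constructor
  · refine fun h => ⟨fun c hc => ?_, fun c hc => ?_⟩
    · have := h c
      rw [if_pos hc.1, if_neg hc.2] at this
      simpa using this
    · by_contra hn
      have := h c
      rw [if_neg hn] at this
      exact hc (by simpa using this)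
  · rintro ⟨h1, h2⟩ c
    split_ifs with hc hf
    · trivial
    · simpa using h1 c ⟨hc, hf⟩
    · by_contra h
      exact hc (h2 c (by simpa using h))

theorem stateOf_eq_subset (σ : Set C) :
    {ω | R.stateOf ω = σ} ⊆ Set.univ.pi (R.dartBox σ) := fun ω h =>
  (R.mem_pi_dartBox_iff σ ω).2 ((R.state_eq_iff _ _).1 h).1

/-- The probability that the content of the cell `c` is as required by the state `σ`. -/
noncomputable def cellProb (t : ℝ) (c : C) (σ : Set C) : ℝ :=
  R.cellVal (Real.exp (-(R.size c * t))) (1 - Real.exp (-(R.size c * t))) 1 c σ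

theorem poissonMeasure_real_zero (r : ℝ≥0) : (poissonMeasure r).real {0} = Real.exp (-r) := by
  rw [poissonMeasure_real_singleton]
  simp

theorem poissonMeasure_dartBox {t : ℝ} (ht : 0 < t) (c : C) (σ : Set C) :
    (poissonMeasure (R.size c * t.toNNReal)).real (R.dartBox σ c) = R.cellProb t c σ := by
  have h : ((R.size c * t.toNNReal : ℝ≥0) : ℝ) = R.size c * t := by
    rw [NNReal.coe_mul, Real.coe_toNNReal _ ht.le]
  rw [dartBox, R.apply_cellVal (fun s => (poissonMeasure (R.size c * t.toNNReal)).real s)]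
  rw [probReal_compl_eq_one_sub (measurableSet_singleton 0), poissonMeasure_real_zero, h,
    probReal_univ, cellProb]

/-- The probability of a state is at most the product of the cell probabilities. -/
theorem prob_le_prod {t : ℝ} (ht : 0 < t) (σ : Set C) (F : Finset C) :
    (R.dartLaw t).real {ω | R.stateOf ω = σ} ≤ ∏ c ∈ F, R.cellProb t c σ := by
  have h : (R.dartLaw t).real ((F : Set C).pi (R.dartBox σ)) = ∏ c ∈ F, R.cellProb t c σ := by
    rw [measureReal_def, dartLaw, Measure.infinitePi_pi _ fun _ _ => MeasurableSet.of_discrete,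
      ENNReal.toReal_prod]
    exact Finset.prod_congr rfl fun c _ => R.poissonMeasure_dartBox ht c σ
  rw [← h]
  exact measureReal_mono ((R.stateOf_eq_subset σ).trans fun ω h c _ => h c trivial)

theorem tendsto_prod_cellProb [Countable C] {t : ℝ} (ht : 0 < t) (σ : Set C) :
    Filter.Tendsto (fun F : Finset C => ∏ c ∈ F, R.cellProb t c σ) Filter.atTop
      (nhds ((R.dartLaw t).real (Set.univ.pi (R.dartBox σ)))) := by
  have h1 : R.dartLaw t (Set.univ.pi (R.dartBox σ)) =
      ∏' c, poissonMeasure (R.size c * t.toNNReal) (R.dartBox σ c) := by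
    rw [dartLaw, Measure.infinitePi_pi_univ _ fun _ => MeasurableSet.of_discrete]
  have h2 : Filter.Tendsto
      (fun F : Finset C => ∏ c ∈ F, poissonMeasure (R.size c * t.toNNReal) (R.dartBox σ c))
      Filter.atTop (nhds (R.dartLaw t (Set.univ.pi (R.dartBox σ)))) := by
    rw [h1, ENNReal.tprod_eq_iInf_prod fun _ => prob_le_one]
    exact tendsto_atTop_iInf (Finset.prod_anti_set_of_le_one' fun _ => prob_le_one)
  have h3 := (ENNReal.tendsto_toReal (measure_ne_top _ _)).comp h2
  refine h3.congr fun F => ?_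
  simp only [Function.comp, ENNReal.toReal_prod]
  exact Finset.prod_congr rfl fun c _ => R.poissonMeasure_dartBox ht c σ

instance {C : Type*} [Countable C] : MeasurableSingletonClass (Set C) where
  measurableSet_singleton σ := by
    have e : ({σ} : Set (Set C)) = ⋂ c, {τ | c ∈ τ ↔ c ∈ σ} := by
      ext τ
      simp [Set.ext_iff]
    rw [e]
    refine MeasurableSet.iInter fun c => ?_
    exact ((measurable_set_mem c).iff measurable_const).setOf

theorem measurableSet_setOf_stateOf_eq [Countable C] (hm : Measurable R.stateOf) (σ : Set C) :
    MeasurableSet {ω | R.stateOf ω = σ} :=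
  hm (measurableSet_singleton σ)

/-- A state that has positive probability has the product of the cell probabilities as its
probability. -/
theorem prob_eq_of_pos [Countable C] (hm : Measurable R.stateOf) (t : ℝ) (σ : Set C)
    (hpos : (R.dartLaw t).real {ω | R.stateOf ω = σ} ≠ 0) :
    (R.dartLaw t).real {ω | R.stateOf ω = σ} =
      (R.dartLaw t).real (Set.univ.pi (R.dartBox σ)) := by
  classical
  -- Essential cells get one dart, inessential cells of `σ` outside `F` keep their darts, and all
  -- others are emptied. Thus `Φ F` ignores the cells of `F`, and its hits are those in the second
  -- condition of `state_eq_iff`.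
  set Φ : Set C → (C → ℕ) → C → ℕ := fun F ω c =>
    if c ∈ R.essential σ then 1 else if c ∈ σ ∧ c ∉ F then ω c else 0 with hΦ
  have hset : ∀ F ω, {c | Φ F ω c ≠ 0} = ({c | ω c ≠ 0} \ F) ∩ σ ∪ R.essential σ := by
    intro F ω
    ext c
    simp only [hΦ, Set.mem_ofPred_eq, Set.mem_union, Set.mem_inter_iff, Set.mem_sdiff]
    split_ifs with h1 h2 <;> simp <;> tauto
  set W : Set (C → ℕ) := {ω | R.stateOf (Φ ∅ ω) = σ} with hW
  have hWF : ∀ F : Set C, F.Finite → W = {ω | R.stateOf (Φ F ω) = σ} := by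
    intro F hF
    ext ω
    simp only [hW, Set.mem_ofPred_eq, stateOf, hset, Set.sdiff_empty]
    exact (R.state_diff_finite _ _ hF).symm
  have h01 : R.dartLaw t W = 0 ∨ R.dartLaw t W = 1 := by
    apply R.zero_or_one_of_tail
    intro F hF
    rw [hWF F hF]
    have hΦm : Measurable[coordSigma Fᶜ] (Φ F) := by
      apply measurable_coordSigma_pi
      intro c
      by_cases h1 : c ∈ R.essential σ
      · exact Or.inl ⟨1, fun ω => by simp [hΦ, h1]⟩
      · by_cases h2 : c ∈ σ ∧ c ∉ F
        · exact Or.inr ⟨h2.2, fun ω => by simp [hΦ, h1, h2]⟩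
        · exact Or.inl ⟨0, fun ω => by simp only [hΦ, if_neg h1, if_neg h2]⟩
    exact hΦm (R.measurableSet_setOf_stateOf_eq hm σ)
  have hinter : {ω | R.stateOf ω = σ} = Set.univ.pi (R.dartBox σ) ∩ W := by
    ext ω
    rw [Set.mem_inter_iff, R.mem_pi_dartBox_iff]
    simp only [Set.mem_ofPred_eq, hW, stateOf, hset, Set.sdiff_empty]
    exact R.state_eq_iff _ _
  rcases h01 with h | h
  · refine absurd ?_ hpos
    rw [hinter, measureReal_def, measure_mono_null Set.inter_subset_right h, ENNReal.toReal_zero]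
  · have hWm : MeasurableSet W := by
      rw [hW]
      refine (?_ : Measurable (Φ ∅)) (R.measurableSet_setOf_stateOf_eq hm σ)
      refine measurable_pi_lambda _ fun c => ?_
      simp only [hΦ]
      split_ifs
      exacts [measurable_const, measurable_pi_apply c, measurable_const]
    rw [hinter, measureReal_def, measureReal_def]
    congr 1
    refine measure_inter_conull ?_
    exact (prob_compl_eq_zero_iff hWm).2 h

end Probability
end LinearRule

/-- The forcing rule is an arbitrary monotone function and need not be measurable. The law of the
state is carried by countably many sets, where every function is almost everywhere measurable. -/
theorem aemeasurable_of_ae_mem_countable {α β : Type*} [MeasurableSpace α]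
    [MeasurableSingletonClass α] [MeasurableSpace β] [Zero β] {ν : Measure α} {D : Set α}
    (hD : D.Countable) (h : ∀ᵐ a ∂ν, a ∈ D) (f : α → β) : AEMeasurable f ν := by
  refine ⟨D.indicator f, ?_, ?_⟩
  · refine (measurable_zero (α := β) (β := α)).measurable_of_countable_ne (hD.mono fun a ha => ?_)
    by_contra hn
    exact ha (by simp [hn])
  · filter_upwards [h] with a ha
    simp [ha]

/-! ### Monotonicity in time, and independence of a cell from its predecessors -/

namespace LinearRule

variable {C : Type*} [LinearOrder C] (R : LinearRule C)

/-- Decreasing events become less likely as time passes. -/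
theorem dartLaw_anti {U : Set (C → ℕ)}
    (hU : ∀ ω ω' : C → ℕ, (∀ c, ω c ≤ ω' c) → ω' ∈ U → ω ∈ U) {s t : ℝ} (hs : 0 < s) (hst : s ≤ t)
    (hUs : NullMeasurableSet U (R.dartLaw s)) (hUt : NullMeasurableSet U (R.dartLaw t)) :
    R.dartLaw t U ≤ R.dartLaw s U := by
  -- Coupling: the darts up to time `s` and those between `s` and `t` are drawn independently. The
  -- first components have the law at `s`, the sums the law at `t`.
  set κ : Measure (C → ℕ × ℕ) := Measure.infinitePi fun c =>
    (poissonMeasure (R.size c * s.toNNReal)).prod (poissonMeasure (R.size c * (t - s).toNNReal))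
  have h1 : κ.map (fun ω c => (ω c).1) = R.dartLaw s := by
    rw [Measure.infinitePi_map_pi (f := fun _ (p : ℕ × ℕ) => p.1) _ fun _ => measurable_fst, dartLaw]
    congr
    funext c
    simp
  have h2 : κ.map (fun ω c => (ω c).1 + (ω c).2) = R.dartLaw t := by
    rw [Measure.infinitePi_map_pi (f := fun _ (p : ℕ × ℕ) => p.1 + p.2) _ fun _ => by fun_prop, dartLaw]
    congr
    funext c
    have := poissonMeasure_conv_poissonMeasure (R.size c * s.toNNReal)
      (R.size c * (t - s).toNNReal)
    rw [Measure.conv, ← mul_add, ← Real.toNNReal_add hs.le (sub_nonneg.2 hst)] at this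
    simpa using this
  have m1 : Measurable fun (ω : C → ℕ × ℕ) c => (ω c).1 := by fun_prop
  have m2 : Measurable fun (ω : C → ℕ × ℕ) c => (ω c).1 + (ω c).2 := by fun_prop
  have e1 : R.dartLaw s U = κ ((fun ω c => (ω c).1) ⁻¹' U) := by
    rw [← h1] at hUs ⊢
    exact Measure.map_apply₀ m1.aemeasurable hUs
  have e2 : R.dartLaw t U = κ ((fun ω c => (ω c).1 + (ω c).2) ⁻¹' U) := by
    rw [← h2] at hUt ⊢
    exact Measure.map_apply₀ m2.aemeasurable hUt
  rw [e1, e2]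
  exact measure_mono fun ω hω => hU _ _ (fun c => Nat.le_add_right _ _) hω

/-- The law of the state at time `t`. -/
noncomputable def stateLaw (t : ℝ) : Measure (Set C) := (R.dartLaw t).map R.stateOf

open Classical in
/-- The indicator of the event that the cell `c` is not forced by the cells of `τ`. -/
noncomputable def freeInd (c : C) (τ : Set C) : ℝ := if R.force c τ then 0 else 1

theorem freeInd_nonneg (c : C) (τ : Set C) : 0 ≤ R.freeInd c τ := by
  unfold freeInd
  split_ifs <;> norm_num

/-- The probability that the cell `c` is not forced at time `t`. -/
noncomputable def freeProb (c : C) (t : ℝ) : ℝ :=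
  ∫ σ, R.freeInd c (σ ∩ Set.Iio c) ∂(R.stateLaw t)

theorem freeProb_nonneg (c : C) (t : ℝ) : 0 ≤ R.freeProb c t :=
  integral_nonneg fun _ => R.freeInd_nonneg _ _

/-- A cell that is not forced is occupied exactly when it is hit. With value 0 on forced cells,
`cellVal` thus factors into a function of the preceding cells and a function of the cell's own
darts. -/
theorem cellVal_stateOf (k0 k1 : ℝ) (c : C) (ω : C → ℕ) :
    R.cellVal k0 k1 0 c (R.stateOf ω) =
      R.freeInd c (R.stateOf ω ∩ Set.Iio c) * (if ω c = 0 then k0 else k1) := by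
  have h := R.mem_state_iff {c | ω c ≠ 0} c
  rw [← stateOf] at h
  unfold cellVal freeInd
  by_cases hf : R.force c (R.stateOf ω ∩ Set.Iio c) <;> by_cases h0 : ω c = 0 <;>
    simp_all [stateOf]

theorem integral_poisson_ite (r : ℝ≥0) (k0 k1 : ℝ) :
    ∫ n : ℕ, (if n = 0 then k0 else k1) ∂poissonMeasure r =
      Real.exp (-r) * k0 + (1 - Real.exp (-r)) * k1 := by
  have e : (fun n : ℕ => if n = 0 then k0 else k1) =
      fun n => k1 + ({0} : Set ℕ).indicator (fun _ => k0 - k1) n := by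
    funext n
    by_cases h : n = 0 <;> simp [h]
  rw [e, integral_add (integrable_const _)
    ((integrable_const _).indicator (measurableSet_singleton 0)),
    integral_indicator_const _ (measurableSet_singleton 0), poissonMeasure_real_zero]
  simp
  ring

theorem isProbabilityMeasure_stateLaw (hm : Measurable R.stateOf) (t : ℝ) :
    IsProbabilityMeasure (R.stateLaw t) :=
  Measure.isProbabilityMeasure_map hm.aemeasurable

section Atomic

variable [Countable C] (hm : Measurable R.stateOf) {t : ℝ} {D : Set (Set C)}
  (hD : D.Countable) (hDt : ∀ᵐ σ ∂(R.stateLaw t), σ ∈ D)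

include hm hD hDt in
theorem integral_stateLaw (f : Set C → ℝ) :
    ∫ σ, f σ ∂(R.stateLaw t) = ∫ ω, f (R.stateOf ω) ∂(R.dartLaw t) :=
  integral_map hm.aemeasurable (aemeasurable_of_ae_mem_countable hD hDt f).aestronglyMeasurable

include hm hD hDt in
/-- The darts in the cell `c` are independent of the cells occupied before it. -/
theorem integral_mul_cellVal (ht : 0 < t) (c : C) (g : Set C → ℝ) (k0 k1 : ℝ) :
    ∫ σ, g (σ ∩ Set.Iio c) * R.cellVal k0 k1 0 c σ ∂(R.stateLaw t) =
      (∫ σ, g (σ ∩ Set.Iio c) * R.freeInd c (σ ∩ Set.Iio c) ∂(R.stateLaw t)) *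
        (Real.exp (-(R.size c * t)) * k0 + (1 - Real.exp (-(R.size c * t))) * k1) := by
  classical
  rw [R.integral_stateLaw hm hD hDt, R.integral_stateLaw hm hD hDt]
  set V : (C → ℕ) → Set C := fun ω => R.stateOf ω ∩ Set.Iio c with hV
  -- Erasing the darts from `c` onwards does not change `V`, which is therefore measurable with
  -- respect to the cells before `c`.
  set T : (C → ℕ) → C → ℕ := fun ω d => if d < c then ω d else 0 with hT
  have hVT : V = fun ω => R.stateOf (T ω) ∩ Set.Iio c := by
    funext ω
    rw [hV]
    simp only [stateOf]
    rw [← R.state_inter_Iio]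
    congr 2
    ext d
    by_cases h : d < c <;> simp [hT, h]
  have hcap : Measurable fun σ : Set C => σ ∩ Set.Iio c :=
    measurable_set_iff.2 fun d => (measurable_set_mem d).and measurable_const
  have hVm : Measurable[coordSigma (Set.Iio c)] V := by
    rw [hVT]
    refine (hcap.comp hm).comp (measurable_coordSigma_pi fun d => ?_)
    by_cases h : d < c
    · exact Or.inr ⟨h, fun ω => by simp [hT, h]⟩
    · exact Or.inl ⟨0, fun ω => by simp [hT, h]⟩
  have hind : IndepFun V (fun ω => ω c) (R.dartLaw t) := by
    refine indep_of_indep_of_le_left (indep_of_indep_of_le_right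
      (R.indep_coordSigma t (S := Set.Iio c) (T := {c}) (by simp))
      (measurable_coordSigma (S := {c}) rfl).comap_le) ?_
    exact hVm.comap_le
  have hVm' : Measurable V := hcap.comp hm
  have hVD : ∀ᵐ τ ∂(R.dartLaw t).map V, τ ∈ (fun σ => σ ∩ Set.Iio c) '' D := by
    have h1 : (R.dartLaw t).map V = (R.stateLaw t).map (fun σ => σ ∩ Set.Iio c) := by
      rw [stateLaw, Measure.map_map hcap hm]
      rfl
    rw [h1]
    refine (ae_map_iff hcap.aemeasurable (p := (· ∈ (fun σ => σ ∩ Set.Iio c) '' D))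
      (hD.image _).measurableSet).2 ?_
    filter_upwards [hDt] with σ hσ using ⟨σ, hσ, rfl⟩
  have hprod := hind.integral_fun_comp_mul_comp hVm'.aemeasurable
    (measurable_pi_apply c).aemeasurable
    (f := fun τ => g τ * R.freeInd c τ) (g := fun n => if n = 0 then k0 else k1)
    (aemeasurable_of_ae_mem_countable (hD.image _) hVD _).aestronglyMeasurable
    (Measurable.of_discrete.aestronglyMeasurable)
  have hk : ∫ ω, (if ω c = 0 then k0 else k1) ∂(R.dartLaw t) =
      Real.exp (-(R.size c * t)) * k0 + (1 - Real.exp (-(R.size c * t))) * k1 := by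
    have h1 := integral_poisson_ite (R.size c * t.toNNReal) k0 k1
    rw [NNReal.coe_mul, Real.coe_toNNReal _ ht.le] at h1
    rw [← h1, ← Measure.infinitePi_map_eval
      (fun c => poissonMeasure (R.size c * t.toNNReal)) c,
      integral_map (measurable_pi_apply c).aemeasurable
        Measurable.of_discrete.aestronglyMeasurable]
    rfl
  rw [hk] at hprod
  rw [← hprod]
  refine integral_congr_ae (Filter.Eventually.of_forall fun ω => ?_)
  simp only [R.cellVal_stateOf, hV]
  ring

end Atomic

/-- The probability that a cell is not forced decreases with time. -/
theorem freeProb_anti [Countable C] (hm : Measurable R.stateOf) {D : Set (Set C)}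
    (hD : D.Countable) (hDt : ∀ t, 0 < t → ∀ᵐ σ ∂(R.stateLaw t), σ ∈ D) (c : C) {s t : ℝ}
    (hs : 0 < s) (hst : s ≤ t) : R.freeProb c t ≤ R.freeProb c s := by
  classical
  set U : Set (C → ℕ) := {ω | ¬ R.force c (R.stateOf ω ∩ Set.Iio c)}
  have hU : ∀ t, 0 < t → NullMeasurableSet U (R.dartLaw t) ∧
      R.freeProb c t = (R.dartLaw t).real U := by
    intro t ht
    have hn : NullMeasurableSet U (R.dartLaw t) := by
      have h1 := aemeasurable_of_ae_mem_countable hD (hDt t ht)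
        (fun σ => R.freeInd c (σ ∩ Set.Iio c))
      have h2 := (h1.comp_measurable hm).nullMeasurable (measurableSet_singleton (1 : ℝ))
      convert h2 using 1
      ext ω
      by_cases h : R.force c (R.stateOf ω ∩ Set.Iio c) <;> simp [U, h, freeInd]
    refine ⟨hn, ?_⟩
    have h1 : (R.dartLaw t).real U = ∫ ω, U.indicator (fun _ => (1 : ℝ)) ω ∂(R.dartLaw t) := by
      rw [integral_indicator₀ hn]
      simp
    rw [freeProb, R.integral_stateLaw hm hD (hDt t ht), h1]
    refine integral_congr_ae (Filter.Eventually.of_forall fun ω => ?_)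
    by_cases h : R.force c (R.stateOf ω ∩ Set.Iio c) <;> simp [U, h, freeInd]
  rw [(hU t (hs.trans_le hst)).2, (hU s hs).2]
  refine ENNReal.toReal_mono (measure_ne_top _ _)
    (R.dartLaw_anti ?_ hs hst (hU s hs).1 (hU t (hs.trans_le hst)).1)
  intro ω ω' hle hω' hf
  refine hω' (R.force_mono _ _ _ (Set.inter_subset_inter_left _ (R.state_mono ?_)) hf)
  intro d hd
  exact (lt_of_lt_of_le (Nat.pos_of_ne_zero hd) (hle d)).ne'

end LinearRule

/-! ### Scores and surprisals of cells -/

/-- If functions that lie below their tangents at `t` converge near `t` to a function that is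
differentiable at `t`, then their slopes at `t` converge to its derivative. -/
theorem tendsto_slope_of_tangent {ι : Type*} {l : Filter ι} {f : ℝ → ℝ} {t D : ℝ}
    (hf : HasDerivAt f D t) {g : ι → ℝ → ℝ} {d : ι → ℝ}
    (hlim : ∀ᶠ s in nhds t, Filter.Tendsto (fun i => g i s) l (nhds (f s)))
    (htan : ∀ᶠ s in nhds t, ∀ i, g i s - g i t ≤ d i * (s - t)) :
    Filter.Tendsto d l (nhds D) := by
  have hs : Filter.Tendsto (slope f t) (nhdsWithin t {t}ᶜ) (nhds D) := hf.tendsto_slope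
  have hslope : ∀ᶠ s in nhds t, Filter.Tendsto (fun i => slope (g i) t s) l
      (nhds (slope f t s)) := by
    filter_upwards [hlim] with s h
    simp only [slope_def_field]
    exact (h.sub hlim.self_of_nhds).div_const _
  rw [tendsto_order]
  constructor
  · intro a ha
    -- To the right of `t` the tangent bounds the slope of `g i` from above by `d i`; to the left,
    -- in the second case, from below.
    have h1 : ∀ᶠ s in nhdsWithin t (Set.Ioi t), a < slope f t s :=
      (hs.mono_left (nhdsWithin_mono t fun s hs => ne_of_gt hs)).eventually (lt_mem_nhds ha)
    obtain ⟨s, ⟨⟨has, hl⟩, ht⟩, hst⟩ := (((h1.and (hslope.filter_mono nhdsWithin_le_nhds)).and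
      (htan.filter_mono nhdsWithin_le_nhds)).and self_mem_nhdsWithin).exists
    filter_upwards [hl.eventually (lt_mem_nhds has)] with i hi
    refine hi.trans_le ?_
    rw [slope_def_field, div_le_iff₀ (sub_pos.2 hst)]
    exact ht i
  · intro a ha
    have h1 : ∀ᶠ s in nhdsWithin t (Set.Iio t), slope f t s < a :=
      (hs.mono_left (nhdsWithin_mono t fun s hs => ne_of_lt hs)).eventually (gt_mem_nhds ha)
    obtain ⟨s, ⟨⟨has, hl⟩, ht⟩, hst⟩ := (((h1.and (hslope.filter_mono nhdsWithin_le_nhds)).and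
      (htan.filter_mono nhdsWithin_le_nhds)).and self_mem_nhdsWithin).exists
    filter_upwards [hl.eventually (gt_mem_nhds has)] with i hi
    refine lt_of_le_of_lt ?_ hi
    rw [slope_def_field, le_div_iff_of_neg (sub_neg.2 hst)]
    exact ht i

namespace LinearRule

variable {C : Type*} [LinearOrder C] (R : LinearRule C)

/-- The logarithmic derivative of the cell probability. -/
noncomputable def cellScore (t : ℝ) (c : C) (σ : Set C) : ℝ :=
  R.cellVal (-(R.size c : ℝ)) (R.size c / (Real.exp (R.size c * t) - 1)) 0 c σ

/-- The surprisal of the content of a cell. -/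
noncomputable def cellSurprisal (t : ℝ) (c : C) (σ : Set C) : ℝ :=
  R.cellVal (R.size c * t) (-Real.log (1 - Real.exp (-(R.size c * t)))) 0 c σ

theorem neg_log_cellProb (t : ℝ) (c : C) (σ : Set C) :
    -Real.log (R.cellProb t c σ) = R.cellSurprisal t c σ := by
  rw [cellProb, R.apply_cellVal (fun x => -Real.log x)]
  simp [cellSurprisal]

theorem exp_neg_mul_le_one {t : ℝ} (ht : 0 < t) (p : ℝ≥0) : Real.exp (-(p * t)) ≤ 1 :=
  Real.exp_le_one_iff.2 (neg_nonpos.2 (by positivity))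

theorem cellSurprisal_nonneg {t : ℝ} (ht : 0 < t) (c : C) (σ : Set C) :
    0 ≤ R.cellSurprisal t c σ := by
  have h1 := exp_neg_mul_le_one ht (R.size c)
  have h2 := Real.exp_pos (-(R.size c * t))
  unfold cellSurprisal cellVal
  split_ifs
  · exact le_rfl
  · exact neg_nonneg.2 (Real.log_nonpos (by linarith) (by linarith))
  · positivity

/-- This is the tangent inequality for the concave function `s ↦ log (1 - e^{-ps})`, obtained from
`log y ≤ y - 1` and `1 + y ≤ e^y`. For `p = 0` both sides vanish, since `log 0 = 0`. -/
theorem log_one_sub_exp_sub_le {s t : ℝ} (hs : 0 < s) (ht : 0 < t) (p : ℝ≥0) :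
    Real.log (1 - Real.exp (-(p * s))) - Real.log (1 - Real.exp (-(p * t))) ≤
      p / (Real.exp (p * t) - 1) * (s - t) := by
  rcases eq_or_ne p 0 with rfl | hp
  · simp
  have hp : (0 : ℝ) < p := by positivity
  have e1 : Real.exp (-(p * s)) < 1 := Real.exp_lt_one_iff.2 (by have := mul_pos hp hs; linarith)
  have e2 : Real.exp (-(p * t)) < 1 := Real.exp_lt_one_iff.2 (by have := mul_pos hp ht; linarith)
  have e3 : Real.exp (-(p * t)) * (1 + -(p * (s - t))) ≤ Real.exp (-(p * s)) := by
    have : Real.exp (-(p * s)) = Real.exp (-(p * t)) * Real.exp (-(p * (s - t))) := by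
      rw [← Real.exp_add]
      congr 1
      ring
    rw [this]
    refine mul_le_mul_of_nonneg_left ?_ (Real.exp_pos _).le
    linarith [Real.add_one_le_exp (-(p * (s - t)))]
  have hb : 0 < 1 - Real.exp (-(p * t)) := by linarith
  rw [← Real.log_div (by linarith) hb.ne']
  refine (Real.log_le_sub_one_of_pos (div_pos (by linarith) hb)).trans ?_
  have e4 : Real.exp (p * t) = (Real.exp (-(p * t)))⁻¹ := by rw [Real.exp_neg, inv_inv]
  have e5 : (p : ℝ) / (Real.exp (p * t) - 1) =
      p * Real.exp (-(p * t)) / (1 - Real.exp (-(p * t))) := by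
    rw [e4]
    have := Real.exp_pos (-(p * t))
    field_simp
  rw [e5, div_mul_eq_mul_div, sub_le_iff_le_add, div_le_iff₀ hb, add_mul,
    div_mul_cancel₀ _ hb.ne']
  linarith

theorem log_cellProb_sub_le {s t : ℝ} (hs : 0 < s) (ht : 0 < t) (c : C) (σ : Set C) :
    Real.log (R.cellProb s c σ) - Real.log (R.cellProb t c σ) ≤
      R.cellScore t c σ * (s - t) := by
  unfold cellProb cellScore cellVal
  split_ifs
  · simp
  · exact log_one_sub_exp_sub_le hs ht _
  · rw [Real.log_exp, Real.log_exp]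
    exact le_of_eq (by ring)

theorem cellVal_inter_Iio {α : Type*} (a b e : α) {c d : C} (h : c < d) (σ : Set C) :
    R.cellVal a b e c (σ ∩ Set.Iio d) = R.cellVal a b e c σ := by
  have : σ ∩ Set.Iio d ∩ Set.Iio c = σ ∩ Set.Iio c := by
    rw [Set.inter_assoc, Set.inter_eq_right.2 (Set.Iio_subset_Iio h.le)]
  have h' : c ∈ σ ∩ Set.Iio d ↔ c ∈ σ := by simp [h]
  unfold cellVal
  rw [this]
  by_cases hc : c ∈ σ
  · rw [if_pos hc, if_pos (h'.2 hc)]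
  · rw [if_neg hc, if_neg (fun hn => hc (h'.1 hn))]

theorem abs_cellVal_le (a b : ℝ) (c : C) (σ : Set C) :
    |R.cellVal a b 0 c σ| ≤ |a| + |b| := by
  unfold cellVal
  split_ifs <;> simp
  positivity

theorem log_prob_le {t : ℝ} (ht : 0 < t) (σ : Set C) (F : Finset C)
    (hpos : 0 < (R.dartLaw t).real {ω | R.stateOf ω = σ}) :
    Real.log (∏ c ∈ F, R.cellProb t c σ) = ∑ c ∈ F, Real.log (R.cellProb t c σ) ∧
    ∑ c ∈ F, R.cellSurprisal t c σ ≤ -Real.log ((R.dartLaw t).real {ω | R.stateOf ω = σ}) := by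
  have h := R.prob_le_prod ht σ F
  have h1 : Real.log (∏ c ∈ F, R.cellProb t c σ) = ∑ c ∈ F, Real.log (R.cellProb t c σ) :=
    Real.log_prod fun c hc => Finset.prod_ne_zero_iff.1 (hpos.trans_le h).ne' c hc
  refine ⟨h1, ?_⟩
  simp only [← R.neg_log_cellProb]
  rw [Finset.sum_neg_distrib, ← h1]
  exact neg_le_neg (Real.log_le_log hpos h)

/-- Near `t` the probability stays positive, so its logarithm is the limit of the finite sums of
logarithmic cell probabilities. Each summand lies below its tangent, which permits differentiating
the limit without any uniform convergence. -/
theorem tendsto_sum_cellScore [Countable C] (hm : Measurable R.stateOf) {t : ℝ} (ht : 0 < t)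
    {σ : Set C} {ψ : ℝ → ℝ} (hψ : ∀ s, 0 < s → ψ s = (R.dartLaw s).real {ω | R.stateOf ω = σ})
    (hpos : 0 < ψ t) (hd : DifferentiableAt ℝ ψ t) :
    Filter.Tendsto (fun F : Finset C => ∑ c ∈ F, R.cellScore t c σ) Filter.atTop
      (nhds (deriv ψ t / ψ t)) := by
  have h0 : ∀ᶠ s in nhds t, 0 < s := lt_mem_nhds ht
  refine tendsto_slope_of_tangent (f := fun s => Real.log (ψ s))
    (g := fun F s => ∑ c ∈ F, Real.log (R.cellProb s c σ))
    (hd.hasDerivAt.log hpos.ne') ?_ ?_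
  · filter_upwards [h0, hd.continuousAt.eventually (lt_mem_nhds hpos)] with s hs hψs
    rw [hψ s hs] at hψs ⊢
    have h1 := R.tendsto_prod_cellProb hs σ
    rw [← R.prob_eq_of_pos hm s σ hψs.ne'] at h1
    refine (h1.log hψs.ne').congr fun F => ?_
    exact (R.log_prob_le hs σ F hψs).1
  · filter_upwards [h0] with s hs F
    rw [← Finset.sum_sub_distrib, Finset.sum_mul]
    exact Finset.sum_le_sum fun c _ => R.log_cellProb_sub_le hs ht c σ

section Moments

variable [Countable C] (hm : Measurable R.stateOf) {t : ℝ} {D : Set (Set C)}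
  (hD : D.Countable) (hDt : ∀ᵐ σ ∂(R.stateLaw t), σ ∈ D)

include hm hD hDt in
theorem integrable_of_bound (f : Set C → ℝ) (B : ℝ) (hf : ∀ σ, |f σ| ≤ B) :
    Integrable f (R.stateLaw t) := by
  have := R.isProbabilityMeasure_stateLaw hm t
  exact Integrable.of_bound (aemeasurable_of_ae_mem_countable hD hDt f).aestronglyMeasurable B
    (Filter.Eventually.of_forall hf)

include hm hD hDt in
theorem integral_cellVal (ht : 0 < t) (c : C) (k0 k1 : ℝ) :
    ∫ σ, R.cellVal k0 k1 0 c σ ∂(R.stateLaw t) =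
      R.freeProb c t *
        (Real.exp (-(R.size c * t)) * k0 + (1 - Real.exp (-(R.size c * t))) * k1) := by
  simpa [freeProb] using R.integral_mul_cellVal hm hD hDt ht c (fun _ => 1) k0 k1

theorem mean_score (p : ℝ≥0) {t : ℝ} (ht : 0 < t) :
    Real.exp (-(p * t)) * -(p : ℝ) +
      (1 - Real.exp (-(p * t))) * (p / (Real.exp (p * t) - 1)) = 0 := by
  rcases eq_or_ne p 0 with rfl | hp
  · simp
  have hp : (0 : ℝ) < p := by positivity
  have h1 : 1 < Real.exp (p * t) := Real.one_lt_exp_iff.2 (by positivity)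
  rw [Real.exp_neg]
  have : Real.exp (p * t) - 1 ≠ 0 := by linarith
  field_simp
  ring

theorem variance_score (p : ℝ≥0) {t : ℝ} (ht : 0 < t) :
    Real.exp (-(p * t)) * (-(p : ℝ)) ^ 2 +
      (1 - Real.exp (-(p * t))) * (p / (Real.exp (p * t) - 1)) ^ 2 =
        p ^ 2 / (Real.exp (p * t) - 1) := by
  rcases eq_or_ne p 0 with rfl | hp
  · simp
  have hp : (0 : ℝ) < p := by positivity
  have h1 : 1 < Real.exp (p * t) := Real.one_lt_exp_iff.2 (by positivity)
  rw [Real.exp_neg]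
  have : Real.exp (p * t) - 1 ≠ 0 := by linarith
  field_simp
  ring

include hm hD hDt in
-- The score of `c` is a function of the cells before `d`, and given these the score of `d` has mean
-- zero by `mean_score`.
theorem integral_cellScore_mul (ht : 0 < t) {c d : C} (h : c < d) :
    ∫ σ, R.cellScore t c σ * R.cellScore t d σ ∂(R.stateLaw t) = 0 := by
  have h1 := R.integral_mul_cellVal hm hD hDt ht d (R.cellScore t c) (-(R.size d : ℝ))
    (R.size d / (Real.exp (R.size d * t) - 1))
  rw [mean_score _ ht, mul_zero] at h1
  rw [← h1]
  refine integral_congr_ae (Filter.Eventually.of_forall fun σ => ?_)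
  simp only [cellScore, R.cellVal_inter_Iio _ _ _ h]

include hm hD hDt in
theorem integral_cellScore_sq (ht : 0 < t) (c : C) :
    ∫ σ, R.cellScore t c σ * R.cellScore t c σ ∂(R.stateLaw t) =
      R.freeProb c t * (R.size c ^ 2 / (Real.exp (R.size c * t) - 1)) := by
  rw [← variance_score _ ht, ← R.integral_cellVal hm hD hDt ht]
  refine integral_congr_ae (Filter.Eventually.of_forall fun σ => ?_)
  simp only [cellScore]
  rw [← pow_two, R.apply_cellVal (fun x => x ^ 2)]
  simp

include hm hD hDt in
/-- The scores of the cells are orthogonal. -/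
theorem integral_sum_cellScore_sq (ht : 0 < t) (F : Finset C) :
    ∫ σ, (∑ c ∈ F, R.cellScore t c σ) ^ 2 ∂(R.stateLaw t) =
      ∑ c ∈ F, R.freeProb c t * (R.size c ^ 2 / (Real.exp (R.size c * t) - 1)) := by
  have hint : ∀ c d, Integrable (fun σ => R.cellScore t c σ * R.cellScore t d σ)
      (R.stateLaw t) := by
    intro c d
    refine R.integrable_of_bound hm hD hDt _
      ((|-(R.size c : ℝ)| + |R.size c / (Real.exp (R.size c * t) - 1)|) *
        (|-(R.size d : ℝ)| + |R.size d / (Real.exp (R.size d * t) - 1)|)) fun σ => ?_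
    rw [abs_mul]
    exact mul_le_mul (R.abs_cellVal_le _ _ _ _) (R.abs_cellVal_le _ _ _ _) (abs_nonneg _)
      (by positivity)
  simp only [pow_two, Finset.sum_mul_sum]
  rw [integral_finsetSum _ fun c _ => integrable_finsetSum _ fun d _ => hint c d]
  refine Finset.sum_congr rfl fun c hc => ?_
  rw [integral_finsetSum _ fun d _ => hint c d, Finset.sum_eq_single_of_mem c hc]
  · simpa only [pow_two] using R.integral_cellScore_sq hm hD hDt ht c
  · intro d _ hdc
    rcases lt_or_gt_of_ne hdc with h | h
    · simp only [mul_comm (R.cellScore t c _)]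
      exact R.integral_cellScore_mul hm hD hDt ht h
    · exact R.integral_cellScore_mul hm hD hDt ht h

end Moments

end LinearRule

/-! ### Bounding entropy below and Fisher information above by sums over cells -/

namespace SketchIDF

variable {M : Type*} (A : SketchIDF M) {C : Type*} [Countable C] [LinearOrder C]
  (R : LinearRule C) {occ : M → Set C} (hocc : Function.Injective occ)
  (hm : Measurable R.stateOf) {t : ℝ} (ht : 0 < t)
  (hprob : ∀ x, A.prob t x = (R.dartLaw t).real {darts | R.stateOf darts = occ x})

include hm hprob in
theorem stateLaw_singleton (x : M) : R.stateLaw t {occ x} = ENNReal.ofReal (A.prob t x) := by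
  rw [hprob, ofReal_measureReal, LinearRule.stateLaw,
    Measure.map_apply hm (measurableSet_singleton _)]
  rfl

variable [Countable M]

include hocc hm ht hprob in
theorem ae_mem_range : ∀ᵐ σ ∂(R.stateLaw t), σ ∈ Set.range occ := by
  have := R.isProbabilityMeasure_stateLaw hm t
  have hc : (Set.range occ).Countable := Set.countable_range occ
  have h1 : R.stateLaw t (Set.range occ) = 1 := by
    rw [← Set.iUnion_singleton_eq_range, measure_iUnion (fun x y hxy => by simpa using hocc.ne hxy)
      fun x => measurableSet_singleton _]
    simp only [A.stateLaw_singleton R hm hprob]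
    rw [← ENNReal.ofReal_tsum_of_nonneg (A.prob_nonneg t ht) (A.prob_hasSum t ht).summable,
      (A.prob_hasSum t ht).tsum_eq, ENNReal.ofReal_one]
  exact (prob_compl_eq_zero_iff hc.measurableSet).2 h1

include hocc hm ht hprob in
theorem tsum_mul_prob (f : Set C → ℝ≥0∞) :
    ∑' x, f (occ x) * ENNReal.ofReal (A.prob t x) = ∫⁻ σ, f σ ∂(R.stateLaw t) := by
  have hc : (Set.range occ).Countable := Set.countable_range occ
  rw [← Measure.restrict_eq_self_of_ae_mem (A.ae_mem_range R hocc hm ht hprob),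
    lintegral_countable _ hc, tsum_range (g := occ) (fun σ => f σ * R.stateLaw t {σ}) hocc]
  simp only [A.stateLaw_singleton R hm hprob]

include hocc hm ht hprob in
-- A state implies the requirements on the cells of any finite set, so its surprisal is at least the
-- sum of theirs. The expected surprisal of a cell is its Bernoulli entropy times the probability
-- that it is not forced.
theorem tsum_freeProb_le_entropy :
    ∑' c, ENNReal.ofReal
      (R.freeProb c t * bernoulliEntropy (Real.exp (-(R.size c * t))) / Real.log 2) ≤
      A.entropy t := by
  have hD : (Set.range occ).Countable := Set.countable_range occ
  have hDt := A.ae_mem_range R hocc hm ht hprob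
  have hlog : 0 < Real.log 2 := Real.log_pos (by norm_num)
  rw [ENNReal.tsum_eq_iSup_sum]
  refine iSup_le fun F => ?_
  have hint : ∀ c, Integrable (R.cellSurprisal t c) (R.stateLaw t) := fun c =>
    R.integrable_of_bound hm hD hDt _ _ fun σ => R.abs_cellVal_le _ _ _ _
  have h1 : ∑ c ∈ F, ENNReal.ofReal
      (R.freeProb c t * bernoulliEntropy (Real.exp (-(R.size c * t))) / Real.log 2) =
      ∫⁻ σ, ENNReal.ofReal ((∑ c ∈ F, R.cellSurprisal t c σ) / Real.log 2) ∂(R.stateLaw t) := by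
    rw [← ofReal_integral_eq_lintegral_ofReal, integral_div, integral_finsetSum _ fun c _ => hint c,
      Finset.sum_div, ENNReal.ofReal_sum_of_nonneg]
    · refine Finset.sum_congr rfl fun c _ => ?_
      unfold LinearRule.cellSurprisal
      rw [R.integral_cellVal hm hD hDt ht]
      congr 4
      rw [bernoulliEntropy, Real.log_exp]
      ring
    · intro c _
      exact div_nonneg (integral_nonneg fun σ => R.cellSurprisal_nonneg ht c σ) hlog.le
    · exact (integrable_finsetSum _ fun c _ => hint c).div_const _
    · exact Filter.Eventually.of_forall fun σ =>
        div_nonneg (Finset.sum_nonneg fun c _ => R.cellSurprisal_nonneg ht c σ) hlog.le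
  rw [h1, ← A.tsum_mul_prob R hocc hm ht hprob, entropy]
  refine ENNReal.tsum_le_tsum fun x => ?_
  rcases (A.prob_nonneg t ht x).eq_or_lt with h0 | hpos
  · rw [← h0]
    simp
  · rw [← ENNReal.ofReal_mul' hpos.le]
    refine ENNReal.ofReal_le_ofReal ?_
    have h2 := (R.log_prob_le ht (occ x) F (by rwa [← hprob])).2
    rw [← hprob] at h2
    calc (∑ c ∈ F, R.cellSurprisal t c (occ x)) / Real.log 2 * A.prob t x
        ≤ -Real.log (A.prob t x) / Real.log 2 * A.prob t x := by gcongr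
      _ = -(A.prob t x) * Real.logb 2 (A.prob t x) := by
        rw [Real.logb]
        ring

end SketchIDF

namespace SketchIDF

variable {M : Type*} [Countable M] (A : SketchIDF M) {C : Type*} [Countable C] [LinearOrder C]
  (R : LinearRule C) {occ : M → Set C}

/-- The score of a state is a limit of finite sums of cell scores, whose second moments are bounded
by orthogonality. Fatou's lemma is carried out by hand on finite sets of states, because the limit
runs along the net of finite sets of cells. -/
theorem fisherInfo_le_tsum_freeProb (hocc : Function.Injective occ) (hm : Measurable R.stateOf)
    (hprob : ∀ t, 0 < t → ∀ x,
      A.prob t x = (R.dartLaw t).real {darts | R.stateOf darts = occ x}) {t : ℝ} (ht : 0 < t) :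
    A.fisherInfo t ≤ ∑' c, ENNReal.ofReal
      (R.freeProb c t * (R.size c ^ 2 / (Real.exp (R.size c * t) - 1))) := by
  classical
  have hD : (Set.range occ).Countable := Set.countable_range occ
  have hDt := A.ae_mem_range R hocc hm ht (hprob t ht)
  set B := ∑' c, ENNReal.ofReal
      (R.freeProb c t * (R.size c ^ 2 / (Real.exp (R.size c * t) - 1))) with hB
  have hnn : ∀ c, 0 ≤ R.freeProb c t * (R.size c ^ 2 / (Real.exp (R.size c * t) - 1)) := by
    intro c
    have : 1 ≤ Real.exp (R.size c * t) := Real.one_le_exp (by positivity)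
    exact mul_nonneg (R.freeProb_nonneg c t) (div_nonneg (by positivity) (by linarith))
  have hF : ∀ F : Finset C, ∑' x, ENNReal.ofReal
      ((∑ c ∈ F, R.cellScore t c (occ x)) ^ 2) * ENNReal.ofReal (A.prob t x) ≤ B := by
    intro F
    rw [A.tsum_mul_prob R hocc hm ht (hprob t ht)
      (fun σ => ENNReal.ofReal ((∑ c ∈ F, R.cellScore t c σ) ^ 2)),
      ← ofReal_integral_eq_lintegral_ofReal, R.integral_sum_cellScore_sq hm hD hDt ht,
      ENNReal.ofReal_sum_of_nonneg fun c _ => hnn c]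
    · exact ENNReal.sum_le_tsum F
    · refine R.integrable_of_bound hm hD hDt _
        ((∑ c ∈ F, (|-(R.size c : ℝ)| + |R.size c / (Real.exp (R.size c * t) - 1)|)) ^ 2)
        fun σ => ?_
      rw [abs_pow]
      refine pow_le_pow_left₀ (abs_nonneg _) ?_ 2
      exact (Finset.abs_sum_le_sum_abs _ _).trans
        (Finset.sum_le_sum fun c _ => R.abs_cellVal_le _ _ _ _)
    · exact Filter.Eventually.of_forall fun σ => sq_nonneg _
  rw [fisherInfo, ENNReal.tsum_eq_iSup_sum]
  refine iSup_le fun K => ?_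
  -- The discarded states contribute 0, and a nonzero `deriv` guarantees differentiability for the
  -- others.
  set K' := K.filter fun x => deriv (fun s => A.prob s x) t ≠ 0 ∧ A.prob t x ≠ 0 with hK'
  have hsub : ∑ x ∈ K', ENNReal.ofReal
      ((deriv (fun s => A.prob s x) t / A.prob t x) ^ 2 * A.prob t x) =
      ∑ x ∈ K, ENNReal.ofReal
      ((deriv (fun s => A.prob s x) t / A.prob t x) ^ 2 * A.prob t x) := by
    refine Finset.sum_subset (Finset.filter_subset _ _) fun x hx hn => ?_
    have : deriv (fun s => A.prob s x) t = 0 ∨ A.prob t x = 0 := by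
      by_contra! h
      exact hn (Finset.mem_filter.2 ⟨hx, h⟩)
    rcases this with h | h <;> simp [h]
  rw [← hsub]
  have hlim : Filter.Tendsto (fun F : Finset C => ∑ x ∈ K', ENNReal.ofReal
      ((∑ c ∈ F, R.cellScore t c (occ x)) ^ 2 * A.prob t x)) Filter.atTop
      (nhds (∑ x ∈ K', ENNReal.ofReal
        ((deriv (fun s => A.prob s x) t / A.prob t x) ^ 2 * A.prob t x))) := by
    refine tendsto_finsetSum _ fun x hx => ENNReal.tendsto_ofReal ?_
    obtain ⟨_, hd, hp⟩ := Finset.mem_filter.1 hx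
    refine ((R.tendsto_sum_cellScore hm ht (ψ := fun s => A.prob s x)
      (fun s hs => hprob s hs x) ((A.prob_nonneg t ht x).lt_of_ne' hp)
      (differentiableAt_of_deriv_ne_zero hd)).pow 2).mul_const _
  refine le_of_tendsto' hlim fun F => le_trans ?_ (hF F)
  refine le_trans (le_of_eq (Finset.sum_congr rfl fun x _ => ?_)) (ENNReal.sum_le_tsum K')
  exact ENNReal.ofReal_mul (sq_nonneg _)

end SketchIDF

/-! ### The entropy-to-information ratio of one cell is monotone -/

section RatioMonotone

/-- This is `y ≤ sinh y` at `y = -log (1 - v)`. -/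
theorem neg_log_one_sub_le {v : ℝ} (h0 : 0 ≤ v) (h1 : v < 1) :
    -Real.log (1 - v) ≤ v * (2 - v) / (2 * (1 - v)) := by
  have hy : 0 < 1 - v := by linarith
  have hl : 0 ≤ Real.log (1 - v)⁻¹ := Real.log_nonneg ((one_le_inv₀ hy).2 (by linarith))
  have h := Real.self_le_sinh_iff.2 hl
  rw [Real.sinh_log (inv_pos.2 hy), Real.log_inv, inv_inv] at h
  refine h.trans (le_of_eq ?_)
  field_simp
  ring

/-- Up to a positive factor, the difference of the two sides is the derivative of the second summand
of `entropyRatio`. -/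
theorem entropy_slope_ineq {x : ℝ} (hx : 0 < x) :
    -Real.log (1 - Real.exp (-x)) * (x * (1 + Real.exp (-x)) - 2 * (1 - Real.exp (-x))) ≤
      x * Real.exp (-x) := by
  set v := Real.exp (-x) with hv
  have hv0 : 0 < v := Real.exp_pos _
  have hv1 : v < 1 := Real.exp_lt_one_iff.2 (by linarith)
  have hL0 : 0 ≤ -Real.log (1 - v) :=
    neg_nonneg.2 (Real.log_nonpos (by linarith) (by linarith))
  have hL := neg_log_one_sub_le hv0.le hv1
  rcases le_or_gt (x * (1 + v) - 2 * (1 - v)) 0 with h | h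
  · exact (mul_nonpos_of_nonneg_of_nonpos hL0 h).trans (by positivity)
  · refine (mul_le_mul_of_nonneg_right hL h.le).trans ?_
    have hxv : x * v ≤ 1 - v := by
      have h1 : x + 1 ≤ Real.exp x := Real.add_one_le_exp x
      have h2 : Real.exp x * v = 1 := by rw [hv, ← Real.exp_add]; simp
      nlinarith
    rw [div_mul_eq_mul_div, div_le_iff₀ (by linarith)]
    have h3 : x * v * (3 - v) ≤ (1 - v) * (2 * (2 - v)) :=
      mul_le_mul hxv (by linarith) (by linarith) (by linarith)
    nlinarith [mul_le_mul_of_nonneg_left h3 hv0.le]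

/-- The quotient of the entropy and the normalized Fisher information of a cell. -/
noncomputable def entropyRatio (x : ℝ) : ℝ :=
  (1 - Real.exp (-x)) / x +
    (Real.exp x - 2 + Real.exp (-x)) * -Real.log (1 - Real.exp (-x)) / x ^ 2

/-- Both summands are nonincreasing: the first because `(x + 1) e^{-x} ≤ 1`, the second by
`entropy_slope_ineq`. -/
theorem entropyRatio_anti : AntitoneOn entropyRatio (Set.Ioi 0) := by
  have h1 : ∀ x : ℝ, HasDerivAt (fun x => Real.exp (-x)) (-Real.exp (-x)) x := fun x => by
    simpa using (hasDerivAt_neg x).exp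
  have hpos : ∀ x : ℝ, 0 < x → 0 < 1 - Real.exp (-x) := fun x hx =>
    sub_pos.2 (Real.exp_lt_one_iff.2 (by linarith))
  have hd : ∀ x : ℝ, 0 < x → HasDerivAt entropyRatio
      ((Real.exp (-x) * x - (1 - Real.exp (-x)) * 1) / x ^ 2 +
        (((Real.exp x + -Real.exp (-x)) * -Real.log (1 - Real.exp (-x)) +
          (Real.exp x - 2 + Real.exp (-x)) * -(Real.exp (-x) / (1 - Real.exp (-x)))) * x ^ 2 -
          (Real.exp x - 2 + Real.exp (-x)) * -Real.log (1 - Real.exp (-x)) * (2 * x)) /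
            (x ^ 2) ^ 2) x := by
    intro x hx
    have h2 : HasDerivAt (fun x => 1 - Real.exp (-x)) (Real.exp (-x)) x := by
      simpa using (h1 x).const_sub 1
    have h3 : HasDerivAt (fun x => Real.exp x - 2 + Real.exp (-x))
        (Real.exp x + -Real.exp (-x)) x := ((Real.hasDerivAt_exp x).sub_const 2).add (h1 x)
    have h4 := (h2.log (hpos x hx).ne').neg
    have h5 : HasDerivAt (fun x : ℝ => x ^ 2) (2 * x) x := by simpa using hasDerivAt_pow 2 x
    exact (h2.div (hasDerivAt_id x) hx.ne').add ((h3.mul h4).div h5 (by positivity))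
  refine antitoneOn_of_deriv_nonpos (convex_Ioi 0)
    (fun x hx => (hd x hx).continuousAt.continuousWithinAt) ?_ ?_
  · rw [interior_Ioi]
    exact fun x hx => (hd x hx).differentiableAt.differentiableWithinAt
  · rw [interior_Ioi]
    intro x (hx : 0 < x)
    rw [(hd x hx).deriv]
    have hp := hpos x hx
    have hs := entropy_slope_ineq hx
    set L := -Real.log (1 - Real.exp (-x))
    have hee : Real.exp x = (Real.exp (-x))⁻¹ := by rw [Real.exp_neg, inv_inv]
    have hx1 := Real.add_one_le_exp x
    have hv0 : 0 < Real.exp (-x) := Real.exp_pos _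
    rw [hee] at hx1 ⊢
    set v := Real.exp (-x)
    have hxv : (x + 1) * v ≤ 1 := by
      have := mul_le_mul_of_nonneg_right hx1 hv0.le
      rwa [inv_mul_cancel₀ hv0.ne'] at this
    refine add_nonpos ?_ ?_
    · exact div_nonpos_of_nonpos_of_nonneg (by linarith) (by positivity)
    · refine div_nonpos_of_nonpos_of_nonneg ?_ (by positivity)
      have e : ((v⁻¹ + -v) * L + (v⁻¹ - 2 + v) * -(v / (1 - v))) * x ^ 2 -
          (v⁻¹ - 2 + v) * L * (2 * x) =
          x * (1 - v) / v * (L * (x * (1 + v) - 2 * (1 - v)) - x * v) := by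
        field_simp
        ring
      rw [e]
      exact mul_nonpos_of_nonneg_of_nonpos (by positivity) (by linarith)

end RatioMonotone

/-! ### Entropy and information of a cell on the logarithmic scale -/

/-- The entropy (in nats) of a cell, as a function of the logarithm of its expected number of
darts. -/
noncomputable def logEntropy (w : ℝ) : ℝ := bernoulliEntropy (Real.exp (-Real.exp w))

/-- The normalized Fisher information of a cell, as a function of the logarithm of its expected
number of darts. -/
noncomputable def logInfo (w : ℝ) : ℝ := Real.exp w ^ 2 / (Real.exp (Real.exp w) - 1)

theorem exp_exp_sub_one_pos (w : ℝ) : 0 < Real.exp (Real.exp w) - 1 :=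
  sub_pos.2 (Real.one_lt_exp_iff.2 (Real.exp_pos w))

theorem exp_neg_exp_lt_one (w : ℝ) : Real.exp (-Real.exp w) < 1 :=
  Real.exp_lt_one_iff.2 (neg_lt_zero.2 (Real.exp_pos w))

theorem logInfo_pos (w : ℝ) : 0 < logInfo w := by
  have := exp_exp_sub_one_pos w
  unfold logInfo
  positivity

theorem logEntropy_eq (w : ℝ) : logEntropy w = Real.exp w * Real.exp (-Real.exp w) +
    (1 - Real.exp (-Real.exp w)) * -Real.log (1 - Real.exp (-Real.exp w)) := by
  rw [logEntropy, bernoulliEntropy, Real.log_exp]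
  ring

theorem logEntropy_eq_ratio_mul (w : ℝ) :
    logEntropy w = entropyRatio (Real.exp w) * logInfo w := by
  rw [logEntropy_eq, entropyRatio, logInfo]
  have h1 := exp_exp_sub_one_pos w
  have h2 := Real.exp_pos w
  have h3 := Real.exp_pos (-Real.exp w)
  have e : Real.exp (Real.exp w) = (Real.exp (-Real.exp w))⁻¹ := by rw [Real.exp_neg, inv_inv]
  have h4 := exp_neg_exp_lt_one w
  rw [e] at h1 ⊢
  set v := Real.exp (-Real.exp w)
  have h5 : v⁻¹ - 1 ≠ 0 := h1.ne'
  have h6 : 1 - v ≠ 0 := by linarith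
  have h7 : v⁻¹ - 1 = (1 - v) / v := by field_simp
  rw [h7]
  field_simp
  ring

theorem entropy_lower_set {κ w w' : ℝ} (h : w ≤ w') (hw : κ * logInfo w' ≤ logEntropy w') :
    κ * logInfo w ≤ logEntropy w := by
  rw [logEntropy_eq_ratio_mul] at hw ⊢
  have h1 := le_of_mul_le_mul_right hw (logInfo_pos w')
  exact mul_le_mul_of_nonneg_right (h1.trans (entropyRatio_anti (Real.exp_pos w) (Real.exp_pos w')
    (Real.exp_le_exp.2 h))) (logInfo_pos w).le

theorem neg_log_one_sub_exp_nonneg (w : ℝ) : 0 ≤ -Real.log (1 - Real.exp (-Real.exp w)) := by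
  have h1 := exp_neg_exp_lt_one w
  have h2 := Real.exp_pos (-Real.exp w)
  exact neg_nonneg.2 (Real.log_nonpos (by linarith) (by linarith))

theorem le_logEntropy (w : ℝ) : Real.exp w * Real.exp (-Real.exp w) ≤ logEntropy w := by
  rw [logEntropy_eq]
  have := mul_nonneg (sub_pos.2 (exp_neg_exp_lt_one w)).le (neg_log_one_sub_exp_nonneg w)
  linarith

theorem logEntropy_nonneg (w : ℝ) : 0 ≤ logEntropy w :=
  le_trans (by positivity) (le_logEntropy w)

theorem logEntropy_le (w : ℝ) :
    logEntropy w ≤ (Real.exp w + 1) * Real.exp (-Real.exp w) := by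
  rw [logEntropy_eq]
  have h1 := exp_neg_exp_lt_one w
  set v := Real.exp (-Real.exp w)
  have h : 0 < 1 - v := by linarith
  have h2 := Real.log_le_sub_one_of_pos (inv_pos.2 h)
  rw [Real.log_inv] at h2
  have h3 := mul_le_mul_of_nonneg_left h2 h.le
  rw [mul_sub, mul_inv_cancel₀ h.ne'] at h3
  linarith

theorem one_sub_exp_neg_bounds {x : ℝ} (h0 : 0 < x) (h1 : x ≤ 1) :
    x / 2 ≤ 1 - Real.exp (-x) ∧ 1 - Real.exp (-x) ≤ x := by
  refine ⟨?_, by linarith [Real.add_one_le_exp (-x)]⟩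
  have h2 : Real.exp (-x) * (x + 1) ≤ 1 := by
    have := mul_le_mul_of_nonneg_left (Real.add_one_le_exp x) (Real.exp_pos (-x)).le
    rwa [← Real.exp_add, neg_add_cancel, Real.exp_zero] at this
  nlinarith [Real.exp_pos (-x)]

/-- For small `x = e^w` the entropy is of order `x (1 - ln x)`. Together with
`le_logEntropy_of_nonpos` this lets the left tail integral be bounded by the entropy at its
endpoint. -/
theorem logEntropy_le_of_nonpos {w : ℝ} (hw : w ≤ 0) :
    logEntropy w ≤ 2 * (Real.exp w * (1 - w)) := by
  rw [logEntropy_eq]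
  have hx := Real.exp_pos w
  obtain ⟨h1, h2⟩ := one_sub_exp_neg_bounds hx (Real.exp_le_one_iff.2 hw)
  have h3 := exp_neg_exp_lt_one w
  have h4 : -Real.log (1 - Real.exp (-Real.exp w)) ≤ 1 - w := by
    have := Real.log_le_log (by positivity) h1
    rw [Real.log_div hx.ne' two_ne_zero, Real.log_exp] at this
    have := Real.log_two_lt_d9
    linarith
  have h5 := neg_log_one_sub_exp_nonneg w
  have h6 := mul_le_mul h2 h4 h5 hx.le
  nlinarith

theorem le_logEntropy_of_nonpos {w : ℝ} (hw : w ≤ 0) :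
    Real.exp w * (1 - w) ≤ 4 * logEntropy w := by
  rw [logEntropy_eq]
  have hx := Real.exp_pos w
  have hx1 := Real.exp_le_one_iff.2 hw
  obtain ⟨h1, h2⟩ := one_sub_exp_neg_bounds hx hx1
  have h3 := exp_neg_exp_lt_one w
  have h4 : -w ≤ -Real.log (1 - Real.exp (-Real.exp w)) := by
    have := Real.log_le_log (by linarith) h2
    rw [Real.log_exp] at this
    linarith
  have h5 : (1 : ℝ) / 4 ≤ Real.exp (-Real.exp w) := by
    have := Real.exp_le_exp.2 (neg_le_neg hx1)
    have := Real.exp_neg_one_gt_d9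
    linarith
  have h6 := mul_le_mul h1 h4 (by linarith) (by linarith)
  nlinarith

theorem logInfo_le_exp (w : ℝ) : logInfo w ≤ Real.exp w := by
  rw [logInfo, div_le_iff₀ (exp_exp_sub_one_pos w), pow_two]
  exact mul_le_mul_of_nonneg_left (by linarith [Real.add_one_le_exp (Real.exp w)])
    (Real.exp_pos w).le

theorem logInfo_le_of_nonneg {w : ℝ} (hw : 0 ≤ w) :
    logInfo w ≤ 2 * (Real.exp w ^ 2 * Real.exp (-Real.exp w)) := by
  have hx1 := Real.one_le_exp hw
  have h2 : 2 ≤ Real.exp (Real.exp w) := by linarith [Real.add_one_le_exp (Real.exp w)]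
  rw [logInfo, div_le_iff₀ (exp_exp_sub_one_pos w), Real.exp_neg]
  have h3 : (1 : ℝ) ≤ 2 * ((Real.exp (Real.exp w))⁻¹ * (Real.exp (Real.exp w) - 1)) := by
    rw [mul_sub, inv_mul_cancel₀ (by positivity)]
    have := inv_anti₀ two_pos h2
    linarith
  nlinarith [sq_nonneg (Real.exp w)]

theorem continuous_logEntropy : Continuous logEntropy := by
  have e : logEntropy = fun w => Real.exp w * Real.exp (-Real.exp w) +
    (1 - Real.exp (-Real.exp w)) * -Real.log (1 - Real.exp (-Real.exp w)) :=
    funext logEntropy_eq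
  rw [e]
  have : Continuous fun w => Real.log (1 - Real.exp (-Real.exp w)) :=
    Continuous.log (by fun_prop) fun w => (sub_pos.2 (exp_neg_exp_lt_one w)).ne'
  fun_prop

theorem continuous_logInfo : Continuous logInfo :=
  Continuous.div (by fun_prop) (by fun_prop) fun w => (exp_exp_sub_one_pos w).ne'

/-! ### Tail integrals -/

section Tails

theorem integrableOn_exp_mul_one_sub {a : ℝ} (ha : a ≤ 0) :
    IntegrableOn (fun w => Real.exp w * (1 - w)) (Set.Iic a) := by
  have h := (integrableOn_exp_mul_Iic (a := 1 / 2) (by norm_num) a).const_mul (2 : ℝ)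
  refine Integrable.mono' h (Continuous.aestronglyMeasurable (by fun_prop)) ?_
  refine (ae_restrict_mem measurableSet_Iic).mono fun w hw => ?_
  have hw0 : w ≤ 0 := le_trans hw ha
  have h1 : Real.exp w = Real.exp (1 / 2 * w) * Real.exp (1 / 2 * w) := by
    rw [← Real.exp_add]
    congr 1
    ring
  -- Half of the exponential absorbs the linear factor, leaving the integrable majorant `2 e^{w/2}`.
  have h2 : Real.exp (1 / 2 * w) * (1 - 1 / 2 * w) ≤ 1 := by
    have := mul_le_mul_of_nonneg_left (Real.add_one_le_exp (-(1 / 2 * w)))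
      (Real.exp_pos (1 / 2 * w)).le
    rw [← Real.exp_add, add_neg_cancel, Real.exp_zero] at this
    linarith
  have h3 := Real.exp_pos (1 / 2 * w)
  rw [Real.norm_of_nonneg (mul_nonneg (Real.exp_pos _).le (by linarith)), h1]
  nlinarith

theorem integral_exp_mul_one_sub {a : ℝ} (ha : a ≤ 0) :
    ∫ w in Set.Iic a, Real.exp w * (1 - w) = Real.exp a * (2 - a) := by
  have hd : ∀ w ∈ Set.Iic a, HasDerivAt (fun w => Real.exp w * (2 - w))
      (Real.exp w * (1 - w)) w := by
    intro w _
    refine ((Real.hasDerivAt_exp w).mul ((hasDerivAt_id w).const_sub 2)).congr_deriv ?_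
    simp only [id]
    ring
  have hlim : Filter.Tendsto (fun w => Real.exp w * (2 - w)) Filter.atBot (nhds 0) := by
    have h0 := (Real.tendsto_pow_mul_exp_neg_atTop_nhds_zero 0).comp Filter.tendsto_neg_atBot_atTop
    have h1 := (Real.tendsto_pow_mul_exp_neg_atTop_nhds_zero 1).comp Filter.tendsto_neg_atBot_atTop
    have h := (h0.const_mul 2).add h1
    simp only [Function.comp_def, neg_neg, pow_zero, pow_one, mul_zero, add_zero] at h
    exact h.congr fun w => by ring
  rw [integral_Iic_of_hasDerivAt_of_tendsto' hd (integrableOn_exp_mul_one_sub ha) hlim, sub_zero]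

theorem hasDerivAt_tail (w : ℝ) : HasDerivAt
    (fun w => -((Real.exp w + 1) * Real.exp (-Real.exp w)))
    (Real.exp w ^ 2 * Real.exp (-Real.exp w)) w := by
  have h1 := Real.hasDerivAt_exp w
  refine ((h1.add_const 1).mul h1.neg.exp).neg.congr_deriv ?_
  simp only [Pi.neg_apply]
  ring

theorem tendsto_tail : Filter.Tendsto (fun w => -((Real.exp w + 1) * Real.exp (-Real.exp w)))
    Filter.atTop (nhds 0) := by
  have h0 := (Real.tendsto_pow_mul_exp_neg_atTop_nhds_zero 0).comp Real.tendsto_exp_atTop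
  have h1 := (Real.tendsto_pow_mul_exp_neg_atTop_nhds_zero 1).comp Real.tendsto_exp_atTop
  have h := (h0.add h1).neg
  simp only [Function.comp_def, pow_zero, pow_one, add_zero, neg_zero] at h
  exact h.congr fun w => by ring

theorem integrableOn_tail (a : ℝ) :
    IntegrableOn (fun w => Real.exp w ^ 2 * Real.exp (-Real.exp w)) (Set.Ioi a) :=
  integrableOn_Ioi_deriv_of_nonneg' (fun w _ => hasDerivAt_tail w) (fun w _ => by positivity)
    tendsto_tail

theorem integral_tail (a : ℝ) :
    ∫ w in Set.Ioi a, Real.exp w ^ 2 * Real.exp (-Real.exp w) =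
      (Real.exp a + 1) * Real.exp (-Real.exp a) := by
  rw [integral_Ioi_of_hasDerivAt_of_nonneg' (fun w _ => hasDerivAt_tail w)
    (fun w _ => by positivity) tendsto_tail]
  ring

theorem integrable_of_tails {f : ℝ → ℝ} (hf : Continuous f) (h0 : ∀ w, 0 ≤ f w) {K : ℝ}
    (h1 : ∀ w ≤ 0, f w ≤ K * (Real.exp w * (1 - w)))
    (h2 : ∀ w, 0 ≤ w → f w ≤ K * (Real.exp w ^ 2 * Real.exp (-Real.exp w))) : Integrable f := by
  rw [← integrableOn_univ, ← Set.Iic_union_Ioi (a := (0 : ℝ))]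
  refine IntegrableOn.union ?_ ?_
  · refine Integrable.mono' ((integrableOn_exp_mul_one_sub le_rfl).const_mul K)
      hf.aestronglyMeasurable ?_
    refine (ae_restrict_mem measurableSet_Iic).mono fun w hw => ?_
    rw [Real.norm_of_nonneg (h0 w)]
    exact h1 w hw
  · refine Integrable.mono' ((integrableOn_tail 0).const_mul K) hf.aestronglyMeasurable ?_
    refine (ae_restrict_mem measurableSet_Ioi).mono fun w hw => ?_
    rw [Real.norm_of_nonneg (h0 w)]
    exact h2 w (le_of_lt hw)

theorem integrable_logEntropy : Integrable logEntropy := by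
  refine integrable_of_tails continuous_logEntropy logEntropy_nonneg (K := 2)
    (fun w hw => logEntropy_le_of_nonpos hw) fun w hw => (logEntropy_le w).trans ?_
  have h1 := Real.one_le_exp hw
  rw [← mul_assoc]
  refine mul_le_mul_of_nonneg_right ?_ (Real.exp_pos _).le
  nlinarith

theorem integrable_logInfo : Integrable logInfo := by
  refine integrable_of_tails continuous_logInfo (fun w => (logInfo_pos w).le) (K := 2)
    (fun w hw => (logInfo_le_exp w).trans ?_) fun w hw => logInfo_le_of_nonneg hw
  have := Real.exp_pos w
  nlinarith

theorem integral_logInfo_pos : 0 < ∫ w, logInfo w :=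
  integral_pos_of_integrable_nonneg_nonzero continuous_logInfo integrable_logInfo
    (fun w => (logInfo_pos w).le) (logInfo_pos 0).ne'

/-- The majorant integrates to `2 e^a (2 - a) ≤ 4 e^a (1 - a)`, and `le_logEntropy_of_nonpos`
contributes another factor 4. -/
theorem integral_logEntropy_Iic_le {a : ℝ} (ha : a ≤ 0) :
    ∫ w in Set.Iic a, logEntropy w ≤ 16 * logEntropy a := by
  have h1 : ∫ w in Set.Iic a, logEntropy w ≤ ∫ w in Set.Iic a, 2 * (Real.exp w * (1 - w)) :=
    setIntegral_mono_on integrable_logEntropy.integrableOn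
      ((integrableOn_exp_mul_one_sub ha).const_mul 2) measurableSet_Iic
      fun w hw => logEntropy_le_of_nonpos (le_trans hw ha)
  rw [integral_const_mul, integral_exp_mul_one_sub ha] at h1
  have := le_logEntropy_of_nonpos ha
  have := Real.exp_pos a
  nlinarith

theorem integral_logInfo_Ioi_le {a : ℝ} (ha : 0 ≤ a) :
    ∫ w in Set.Ioi a, logInfo w ≤ 4 * logEntropy a := by
  have h1 : ∫ w in Set.Ioi a, logInfo w ≤
      ∫ w in Set.Ioi a, 2 * (Real.exp w ^ 2 * Real.exp (-Real.exp w)) :=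
    setIntegral_mono_on integrable_logInfo.integrableOn
      ((integrableOn_tail a).const_mul 2) measurableSet_Ioi
      fun w hw => logInfo_le_of_nonneg (ha.trans (le_of_lt hw))
  rw [integral_const_mul, integral_tail] at h1
  have h2 := le_logEntropy a
  have h3 := Real.one_le_exp ha
  have h4 := Real.exp_pos (-Real.exp a)
  nlinarith

end Tails

/-! ### Comparing entropy and information under a nonincreasing weight -/

/-- The ratio of the total entropy to the total information of a cell, over all scales. -/
noncomputable def totalRatio : ℝ := (∫ w, logEntropy w) / ∫ w, logInfo w

theorem totalRatio_nonneg : 0 ≤ totalRatio :=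
  div_nonneg (integral_nonneg logEntropy_nonneg) integral_logInfo_pos.le

/-- The excess of the entropy over the information of a cell. -/
noncomputable def excess (w : ℝ) : ℝ := logEntropy w - totalRatio * logInfo w

theorem integrable_excess : Integrable excess :=
  integrable_logEntropy.sub (integrable_logInfo.const_mul _)

theorem continuous_excess : Continuous excess :=
  continuous_logEntropy.sub (continuous_const.mul continuous_logInfo)

theorem integral_excess : ∫ w, excess w = 0 := by
  unfold excess
  rw [integral_sub integrable_logEntropy (integrable_logInfo.const_mul _), integral_const_mul,
    totalRatio, div_mul_cancel₀ _ integral_logInfo_pos.ne', sub_self]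

theorem integral_excess_Iic_add_Ioi (a : ℝ) :
    (∫ w in Set.Iic a, excess w) + ∫ w in Set.Ioi a, excess w = 0 := by
  rw [intervalIntegral.integral_Iic_add_Ioi integrable_excess.integrableOn
    integrable_excess.integrableOn, integral_excess]

theorem excess_lower_set {w w' : ℝ} (h : w ≤ w') (hw : 0 ≤ excess w') : 0 ≤ excess w :=
  sub_nonneg.2 (entropy_lower_set h (sub_nonneg.1 hw))

/-- The excess has total integral zero and is nonnegative on a lower set, so its integral up to any
point is nonnegative. -/
theorem integral_excess_Iic_nonneg (a : ℝ) : 0 ≤ ∫ w in Set.Iic a, excess w := by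
  rcases le_or_gt 0 (excess a) with h | h
  · exact setIntegral_nonneg measurableSet_Iic fun w hw => excess_lower_set hw h
  · have h1 : ∫ w in Set.Ioi a, excess w ≤ 0 := by
      refine setIntegral_nonpos measurableSet_Ioi fun w hw => ?_
      by_contra hn
      exact not_le.2 h (excess_lower_set (le_of_lt hw) (not_le.1 hn).le)
    linarith [integral_excess_Iic_add_Ioi a]

/-- This is the price of starting a time window at `a`. For `a ≤ 0` the left tail of the entropy
bounds it; for `a ≥ 0` the vanishing total integral turns it into the right tail of the information.
-/
theorem integral_excess_Iic_le (a : ℝ) :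
    ∫ w in Set.Iic a, excess w ≤ (16 + 4 * totalRatio) * logEntropy a := by
  have hG := logEntropy_nonneg a
  have hκ := totalRatio_nonneg
  rcases le_total a 0 with ha | ha
  · have h1 : ∫ w in Set.Iic a, excess w ≤ ∫ w in Set.Iic a, logEntropy w :=
      setIntegral_mono integrable_excess.integrableOn integrable_logEntropy.integrableOn
        fun w => sub_le_self _ (mul_nonneg hκ (logInfo_pos w).le)
    have h2 := integral_logEntropy_Iic_le ha
    nlinarith [mul_nonneg hκ hG]
  · have h1 : -(totalRatio * ∫ w in Set.Ioi a, logInfo w) ≤ ∫ w in Set.Ioi a, excess w := by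
      rw [← integral_const_mul, ← integral_neg]
      refine setIntegral_mono (integrable_logInfo.const_mul _).neg.integrableOn
        integrable_excess.integrableOn fun w => ?_
      have := logEntropy_nonneg w
      simp only [excess]
      linarith
    have h2 := mul_le_mul_of_nonneg_left (integral_logInfo_Ioi_le ha) hκ
    have h3 := integral_excess_Iic_add_Ioi a
    nlinarith

/-- A nonincreasing weight does not lower the ratio of entropy to information by more than a
boundary term. -/
theorem totalRatio_mul_integral_le {P : ℝ → ℝ} (hP : Antitone P) (h0 : ∀ w, 0 ≤ P w) {a b : ℝ}
    (hab : a ≤ b) :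
    totalRatio * ∫ w in a..b, P w * logInfo w ≤
      (∫ w in a..b, P w * logEntropy w) + (16 + 4 * totalRatio) * (P a * logEntropy a) := by
  have hPi : ∀ f : ℝ → ℝ, Continuous f → IntervalIntegrable (fun w => P w * f w) volume a b :=
    fun f hf => hP.intervalIntegrable.mul_continuousOn hf.continuousOn
  -- The pivot `m` is the point where the excess changes sign, clipped to `[a, b]`. Left of it the
  -- weight is at least `P m` and the excess nonnegative; right of it both inequalities are
  -- reversed.
  obtain ⟨m, hm, hpiv⟩ : ∃ m ∈ Set.Icc a b, ∀ w ∈ Set.Icc a b,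
      P m * excess w ≤ P w * excess w := by
    have key : ∀ m, (∀ w ∈ Set.Icc a b, w < m → 0 ≤ excess w) →
        (∀ w ∈ Set.Icc a b, m < w → excess w ≤ 0) →
        ∀ w ∈ Set.Icc a b, P m * excess w ≤ P w * excess w := by
      intro m h1 h2 w hw
      rcases lt_trichotomy w m with h | h | h
      · exact mul_le_mul_of_nonneg_right (hP h.le) (h1 w hw h)
      · rw [h]
      · exact mul_le_mul_of_nonpos_right (hP h.le) (h2 w hw h)
    have hneg : ∀ w w', w ≤ w' → excess w < 0 → excess w' ≤ 0 := by
      intro w w' h hw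
      by_contra hn
      exact not_le.2 hw (excess_lower_set h (not_le.1 hn).le)
    rcases lt_or_ge (excess a) 0 with ha | ha
    · exact ⟨a, ⟨le_rfl, hab⟩, key a (fun w hw h => absurd hw.1 (not_le.2 h))
        fun w hw _ => hneg a w hw.1 ha⟩
    rcases le_or_gt 0 (excess b) with hb | hb
    · exact ⟨b, ⟨hab, le_rfl⟩, key b (fun w hw _ => excess_lower_set hw.2 hb)
        fun w hw h => absurd hw.2 (not_le.2 h)⟩
    set S : Set ℝ := {w | 0 ≤ excess w}
    have hSb : b ∈ upperBounds S := by
      intro w hw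
      by_contra hn
      exact not_le.2 hb (excess_lower_set (not_le.1 hn).le hw)
    refine ⟨sSup S, ⟨le_csSup ⟨b, hSb⟩ ha, csSup_le ⟨a, ha⟩ hSb⟩, key _ ?_ ?_⟩
    · intro w _ h
      obtain ⟨w', hw', hlt⟩ := exists_lt_of_lt_csSup ⟨a, ha⟩ h
      exact excess_lower_set hlt.le hw'
    · intro w _ h
      by_contra hn
      exact not_le.2 h (le_csSup ⟨b, hSb⟩ (not_le.1 hn).le)
  have h1 : P m * ∫ w in a..b, excess w ≤ ∫ w in a..b, P w * excess w := by
    rw [← intervalIntegral.integral_const_mul]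
    exact intervalIntegral.integral_mono_on hab
      ((continuous_const.mul continuous_excess).intervalIntegrable _ _)
      (hPi _ continuous_excess) hpiv
  have h2 : ∫ w in a..b, excess w =
      (∫ w in Set.Iic b, excess w) - ∫ w in Set.Iic a, excess w :=
    (intervalIntegral.integral_Iic_sub_Iic integrable_excess.integrableOn
      integrable_excess.integrableOn).symm
  have h3 : ∫ w in a..b, P w * excess w =
      (∫ w in a..b, P w * logEntropy w) - totalRatio * ∫ w in a..b, P w * logInfo w := by
    rw [← intervalIntegral.integral_const_mul, ← intervalIntegral.integral_sub
      (hPi _ continuous_logEntropy) ((hPi _ continuous_logInfo).const_mul _)]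
    refine intervalIntegral.integral_congr fun w _ => ?_
    simp only [excess]
    ring
  have h4 := integral_excess_Iic_nonneg b
  have h5 := integral_excess_Iic_le a
  have h6 : P m ≤ P a := hP hm.1
  have h7 : -((16 + 4 * totalRatio) * (P a * logEntropy a)) ≤ P m * ∫ w in a..b, excess w := by
    have hκ := totalRatio_nonneg
    have hG := logEntropy_nonneg a
    have hC : 0 ≤ (16 + 4 * totalRatio) * logEntropy a := by positivity
    have e1 : P m * -((16 + 4 * totalRatio) * logEntropy a) ≤ P m * ∫ w in a..b, excess w :=
      mul_le_mul_of_nonneg_left (by linarith) (h0 m)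
    nlinarith [mul_le_mul_of_nonneg_right h6 hC]
  linarith

theorem totalRatio_mul_integral_comp_le {u : ℝ → ℝ} (hu : Antitone u) (h0 : ∀ r, 0 ≤ u r)
    {s : ℝ} (hs : 0 < s) (l : ℝ) {a b : ℝ} (hab : a ≤ b) :
    totalRatio * ∫ r in a..b, u r * logInfo (s * r + l) ≤
      (∫ r in a..b, u r * logEntropy (s * r + l)) +
        (16 + 4 * totalRatio) / s * (u a * logEntropy (s * a + l)) := by
  set P : ℝ → ℝ := fun w => u ((w - l) / s) with hPdef
  have hPu : ∀ r, P (s * r + l) = u r := by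
    intro r
    simp only [hPdef, add_sub_cancel_right]
    rw [mul_div_cancel_left₀ _ hs.ne']
  have hP : Antitone P := fun w w' h => hu (by gcongr)
  have h := totalRatio_mul_integral_le hP (fun w => h0 _)
    (show s * a + l ≤ s * b + l by gcongr)
  have e : ∀ f : ℝ → ℝ, ∫ r in a..b, u r * f (s * r + l) =
      s⁻¹ * ∫ w in (s * a + l)..(s * b + l), P w * f w := by
    intro f
    rw [← smul_eq_mul (a := s⁻¹), ← intervalIntegral.integral_comp_mul_add _ hs.ne']
    simp only [hPu]
  rw [e, e]
  have h' := mul_le_mul_of_nonneg_left h (inv_pos.2 hs).le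
  rw [hPu] at h'
  calc _ = s⁻¹ * (totalRatio * ∫ w in (s * a + l)..(s * b + l), P w * logInfo w) := by ring
    _ ≤ _ := h'
    _ = _ := by
      rw [mul_add, div_eq_mul_inv]
      ring

theorem intervalIntegrable_anti_mul {u : ℝ → ℝ} (hu : Antitone u) {f : ℝ → ℝ}
    (hf : Continuous f) (s l a b : ℝ) :
    IntervalIntegrable (fun r => u r * f (s * r + l)) volume a b :=
  hu.intervalIntegrable.mul_continuousOn (hf.comp (by fun_prop)).continuousOn

/-- The entropy at a single left end `a` is not controlled by the entropy averaged over a period.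
Averaging the inequality over `a ∈ [0, 1]` replaces it by an integral that is; the information on
`[0, 1]` is given up. -/
theorem totalRatio_mul_integral_comp_le_averaged {u : ℝ → ℝ} (hu : Antitone u) (h0 : ∀ r, 0 ≤ u r)
    {s : ℝ} (hs : 0 < s) (l : ℝ) {b : ℝ} (hb : 1 ≤ b) :
    totalRatio * ∫ r in (1 : ℝ)..b, u r * logInfo (s * r + l) ≤
      (∫ r in (0 : ℝ)..b, u r * logEntropy (s * r + l)) +
        (16 + 4 * totalRatio) / s * ∫ r in (0 : ℝ)..1, u r * logEntropy (s * r + l) := by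
  have hJ := intervalIntegrable_anti_mul hu continuous_logInfo s l
  have hG := intervalIntegrable_anti_mul hu continuous_logEntropy s l
  have hJ0 : ∀ r, 0 ≤ u r * logInfo (s * r + l) := fun r => mul_nonneg (h0 r) (logInfo_pos _).le
  have hG0 : ∀ r, 0 ≤ u r * logEntropy (s * r + l) :=
    fun r => mul_nonneg (h0 r) (logEntropy_nonneg _)
  set X := totalRatio * ∫ r in (1 : ℝ)..b, u r * logInfo (s * r + l)
  set Y := ∫ r in (0 : ℝ)..b, u r * logEntropy (s * r + l)
  have key : ∀ a ∈ Set.Icc (0 : ℝ) 1,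
      X - Y ≤ (16 + 4 * totalRatio) / s * (u a * logEntropy (s * a + l)) := by
    intro a ha
    have h1 := totalRatio_mul_integral_comp_le hu h0 hs l (ha.2.trans hb)
    have h2 : X ≤ totalRatio * ∫ r in a..b, u r * logInfo (s * r + l) := by
      refine mul_le_mul_of_nonneg_left ?_ totalRatio_nonneg
      exact intervalIntegral.integral_mono_interval ha.2 hb le_rfl
        (Filter.Eventually.of_forall hJ0) (hJ _ _)
    have h3 : ∫ r in a..b, u r * logEntropy (s * r + l) ≤ Y :=
      intervalIntegral.integral_mono_interval ha.1 (ha.2.trans hb) le_rfl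
        (Filter.Eventually.of_forall hG0) (hG _ _)
    linarith
  have h := intervalIntegral.integral_mono_on zero_le_one (intervalIntegrable_const)
    ((hG 0 1).const_mul _) key
  rw [intervalIntegral.integral_const, intervalIntegral.integral_const_mul] at h
  simp only [sub_zero, one_smul] at h
  linarith

theorem ofReal_intervalIntegral {f : ℝ → ℝ} (h0 : ∀ r, 0 ≤ f r) {a b : ℝ} (hab : a ≤ b)
    (hf : IntervalIntegrable f volume a b) :
    ENNReal.ofReal (∫ r in a..b, f r) = ∫⁻ r in Set.Ioc a b, ENNReal.ofReal (f r) := by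
  rw [intervalIntegral.integral_of_le hab,
    ofReal_integral_eq_lintegral_ofReal hf.1 (Filter.Eventually.of_forall h0)]

theorem totalRatio_mul_lintegral_le {u : ℝ → ℝ} (hu : Antitone u) (h0 : ∀ r, 0 ≤ u r)
    {s : ℝ} (hs : 0 < s) (l : ℝ) {b : ℝ} (hb : 1 ≤ b) :
    ENNReal.ofReal (totalRatio / Real.log 2) *
        ∫⁻ r in Set.Ioc 1 b, ENNReal.ofReal (u r * logInfo (s * r + l)) ≤
      (∫⁻ r in Set.Ioc 0 b, ENNReal.ofReal (u r * logEntropy (s * r + l) / Real.log 2)) +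
        ENNReal.ofReal ((16 + 4 * totalRatio) / s) *
          ∫⁻ r in Set.Ioc 0 1, ENNReal.ofReal (u r * logEntropy (s * r + l) / Real.log 2) := by
  have hlog : 0 < Real.log 2 := Real.log_pos (by norm_num)
  have hκ := totalRatio_nonneg
  have hJ := intervalIntegrable_anti_mul hu continuous_logInfo s l
  have hG := fun a b => (intervalIntegrable_anti_mul hu continuous_logEntropy s l a b).div_const
    (Real.log 2)
  have hJ0 : ∀ r, 0 ≤ u r * logInfo (s * r + l) := fun r => mul_nonneg (h0 r) (logInfo_pos _).le
  have hG0 : ∀ r, 0 ≤ u r * logEntropy (s * r + l) / Real.log 2 :=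
    fun r => div_nonneg (mul_nonneg (h0 r) (logEntropy_nonneg _)) hlog.le
  have hb0 : 0 ≤ b := zero_le_one.trans hb
  rw [← ofReal_intervalIntegral hJ0 hb (hJ _ _), ← ofReal_intervalIntegral hG0 hb0 (hG _ _),
    ← ofReal_intervalIntegral hG0 zero_le_one (hG _ _), ← ENNReal.ofReal_mul (by positivity),
    ← ENNReal.ofReal_mul (by positivity), ← ENNReal.ofReal_add
      (intervalIntegral.integral_nonneg hb0 fun r _ => hG0 r)
      (mul_nonneg (by positivity) (intervalIntegral.integral_nonneg zero_le_one fun r _ => hG0 r))]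
  refine ENNReal.ofReal_le_ofReal ?_
  have h := div_le_div_of_nonneg_right (totalRatio_mul_integral_comp_le_averaged hu h0 hs l hb) hlog.le
  rw [intervalIntegral.integral_div, intervalIntegral.integral_div]
  calc _ = _ := by ring
    _ ≤ _ := h
    _ = _ := by ring

/-! ### Many periods, and summation over the cells -/

theorem lintegral_Ioc_of_periodic {φ : ℝ → ℝ≥0∞} (hφ : ∀ r, φ (r + 1) = φ r) (m n : ℕ) :
    ∫⁻ r in Set.Ioc (m : ℝ) (m + n), φ r = n * ∫⁻ r in Set.Ioc (0 : ℝ) 1, φ r := by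
  have hper : ∀ k : ℕ, ∀ r, φ (r + k) = φ r := by
    intro k
    induction k with
    | zero => simp
    | succ k ih =>
      intro r
      rw [Nat.cast_succ, ← add_assoc, hφ, ih]
  have hshift : ∀ k : ℕ, ∫⁻ r in Set.Ioc (k : ℝ) (k + 1), φ r = ∫⁻ r in Set.Ioc (0 : ℝ) 1, φ r := by
    intro k
    rw [← (measurePreserving_add_right volume (k : ℝ)).setLIntegral_comp_preimage_emb
      (measurableEmbedding_addRight _)]
    simp only [hper]
    congr 2
    simp
  induction n with
  | zero => simp
  | succ n ih =>
    have e : Set.Ioc (m : ℝ) (m + (n + 1 : ℕ)) =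
        Set.Ioc (m : ℝ) (m + n) ∪ Set.Ioc ((m + n : ℕ) : ℝ) ((m + n : ℕ) + 1) := by
      push_cast
      rw [Set.Ioc_union_Ioc_eq_Ioc (by simp) (by simp), add_assoc]
    rw [e, lintegral_union measurableSet_Ioc, ih, hshift, Nat.cast_succ, add_mul, one_mul]
    rw [Set.disjoint_left]
    intro r h1 h2
    push_cast at h2
    exact not_lt.2 h1.2 h2.1

/-- Division by `n` removes the error `(1 + K) * H`. The case `H = ∞` is trivial; otherwise `n = 1`
already shows that `κ * I` is finite. -/
theorem mul_le_of_forall_nat {κ I H K : ℝ≥0∞} (hK : K ≠ ∞)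
    (h : ∀ n : ℕ, κ * (n * I) ≤ ((1 + n : ℕ) : ℝ≥0∞) * H + K * H) : κ * I ≤ H := by
  rcases eq_or_ne H ∞ with rfl | hH
  · exact le_top
  have hfin : κ * I ≠ ∞ := by
    have h1 := h 1
    rw [Nat.cast_one, one_mul] at h1
    exact ne_top_of_le_ne_top (by finiteness) h1
  obtain ⟨x, hx⟩ : ∃ x, x = κ * I := ⟨_, rfl⟩
  rw [← hx] at hfin ⊢
  have h' : ∀ n : ℕ, (n : ℝ) * x.toReal ≤ (1 + n) * H.toReal + K.toReal * H.toReal := by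
    intro n
    have h1 := h n
    have e : κ * (n * I) = n * x := by rw [hx]; ring
    rw [e] at h1
    have h2 := ENNReal.toReal_mono (by finiteness) h1
    rw [ENNReal.toReal_add (by finiteness) (by finiteness),
      ENNReal.toReal_mul, ENNReal.toReal_mul, ENNReal.toReal_mul (a := K), ENNReal.toReal_natCast,
      ENNReal.toReal_natCast] at h2
    exact_mod_cast h2
  rw [← ENNReal.toReal_le_toReal hfin hH]
  by_contra hn
  push Not at hn
  obtain ⟨n, hn'⟩ := exists_nat_gt ((1 + K.toReal) * H.toReal / (x.toReal - H.toReal))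
  rw [div_lt_iff₀ (by linarith)] at hn'
  have := h' n
  nlinarith

namespace LinearRule

variable {C : Type*} [LinearOrder C] (R : LinearRule C)

theorem cell_entropy_eq {q : ℝ} (hq : 1 < q) (c : C) (hc : R.size c ≠ 0) (r : ℝ) :
    bernoulliEntropy (Real.exp (-(R.size c * q ^ r))) =
      logEntropy (Real.log q * r + Real.log (R.size c)) := by
  have hp : (0 : ℝ) < R.size c := by positivity
  have hq0 : 0 < q := by linarith
  rw [logEntropy, Real.exp_add, Real.exp_log hp, ← Real.rpow_def_of_pos hq0, mul_comm]

theorem cell_info_eq {q : ℝ} (hq : 1 < q) (c : C) (hc : R.size c ≠ 0) (r : ℝ) :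
    q ^ (2 * r) * (R.size c ^ 2 / (Real.exp (R.size c * q ^ r) - 1)) =
      logInfo (Real.log q * r + Real.log (R.size c)) := by
  have hp : (0 : ℝ) < R.size c := by positivity
  have hq0 : 0 < q := by linarith
  rw [logInfo, Real.exp_add, Real.exp_log hp, ← Real.rpow_def_of_pos hq0, mul_comm (q ^ r) _,
    mul_pow, ← Real.rpow_natCast (q ^ r), ← Real.rpow_mul hq0.le, mul_comm r]
  push_cast
  ring

end LinearRule

theorem constH0_div_constI0 : constH0 / constI0 = totalRatio / Real.log 2 := by
  have h1 : constI0 = ∫ w, logInfo w := rfl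
  have h2 : constH0 = 1 / Real.log 2 * ∫ w, logEntropy w := rfl
  rw [h1, h2, totalRatio]
  ring

theorem corollary5p6 {M : Type*} [Countable M] (A : SketchIDF M) (q : ℝ)
    (hlin : A.Linearizable) (hinv : A.WeaklyScaleInvariant q)
    (hzero : ¬ (A.avgEntropy q = 0 ∧ A.avgInfo q = 0))
    (htop : ¬ (A.avgEntropy q = ∞ ∧ A.avgInfo q = ∞)) :
    ENNReal.ofReal (constH0 / constI0) ≤ A.fish q := by
  obtain ⟨C, _, _, R, occ, hocc, hm, hprob⟩ := hlin
  obtain ⟨hq, hinv⟩ := hinv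
  have hq0 : 0 < q := by linarith
  have hqr : ∀ r : ℝ, 0 < q ^ r := fun r => Real.rpow_pos_of_pos hq0 r
  have hs : 0 < Real.log q := Real.log_pos hq
  -- The side conditions are exactly the exclusion of `0 / 0` and `∞ / ∞`.
  rw [SketchIDF.fish, ENNReal.le_div_iff_mul_le (by tauto) (by tauto), constH0_div_constI0]
  refine mul_le_of_forall_nat (K := ENNReal.ofReal ((16 + 4 * totalRatio) / Real.log q))
    ENNReal.ofReal_ne_top fun n => ?_
  have hanti : ∀ c, Antitone fun r : ℝ => R.freeProb c (q ^ r) := fun c r r' h =>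
    R.freeProb_anti hm (Set.countable_range occ)
      (fun t ht => A.ae_mem_range R hocc hm ht (hprob t ht)) c (hqr r)
      (Real.rpow_le_rpow_of_exponent_le hq.le h)
  set e : C → ℝ → ℝ≥0∞ := fun c r => ENNReal.ofReal (R.freeProb c (q ^ r) *
    bernoulliEntropy (Real.exp (-(R.size c * q ^ r))) / Real.log 2) with he
  set j : C → ℝ → ℝ≥0∞ := fun c r => ENNReal.ofReal (R.freeProb c (q ^ r) *
    (q ^ (2 * r) * (R.size c ^ 2 / (Real.exp (R.size c * q ^ r) - 1)))) with hj
  have hcell : ∀ c, ENNReal.ofReal (totalRatio / Real.log 2) *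
        ∫⁻ r in Set.Ioc (1 : ℝ) (1 + n), j c r ≤
      (∫⁻ r in Set.Ioc (0 : ℝ) (1 + n), e c r) +
        ENNReal.ofReal ((16 + 4 * totalRatio) / Real.log q) *
          ∫⁻ r in Set.Ioc (0 : ℝ) 1, e c r := by
    intro c
    by_cases hc : R.size c = 0
    · simp [hj, hc]
    · simp only [he, hj, R.cell_entropy_eq hq c hc, R.cell_info_eq hq c hc]
      exact totalRatio_mul_lintegral_le (hanti c) (fun r => R.freeProb_nonneg _ _) hs _ (by simp)
  have hpow : Measurable fun r : ℝ => q ^ r :=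
    (Real.continuous_const_rpow hq0.ne').measurable
  have hpow2 : Measurable fun r : ℝ => q ^ (2 * r) := hpow.comp (measurable_const_mul 2)
  have hem : ∀ c, Measurable (e c) := by
    intro c
    have h1 := (hanti c).measurable
    have h2 : Measurable bernoulliEntropy := by
      unfold bernoulliEntropy
      fun_prop
    fun_prop
  have hjm : ∀ c, Measurable (j c) := by
    intro c
    have h1 := (hanti c).measurable
    fun_prop
  have hE : ∀ r, ∑' c, e c r ≤ A.entropy (q ^ r) := fun r =>
    A.tsum_freeProb_le_entropy R hocc hm (hqr r) (hprob _ (hqr r))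
  have hI : ∀ r, ENNReal.ofReal (q ^ (2 * r)) * A.fisherInfo (q ^ r) ≤ ∑' c, j c r := by
    intro r
    have h1 := A.fisherInfo_le_tsum_freeProb R hocc hm hprob (hqr r)
    refine (mul_le_mul_right h1 _).trans (le_of_eq ?_)
    rw [← ENNReal.tsum_mul_left]
    refine tsum_congr fun c => ?_
    rw [← ENNReal.ofReal_mul (hqr _).le]
    congr 1
    ring
  have hsucc : ∀ r : ℝ, q ^ (r + 1) = q * q ^ r := fun r => by
    rw [Real.rpow_add hq0, Real.rpow_one, mul_comm]
  have hEper : ∀ r : ℝ, A.entropy (q ^ (r + 1)) = A.entropy (q ^ r) := fun r => by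
    rw [hsucc, ← (hinv _ (hqr r)).1]
  have hIper : ∀ r : ℝ, ENNReal.ofReal (q ^ (2 * (r + 1))) * A.fisherInfo (q ^ (r + 1)) =
      ENNReal.ofReal (q ^ (2 * r)) * A.fisherInfo (q ^ r) := fun r => by
    rw [hsucc, (hinv _ (hqr r)).2, ← mul_assoc, ← ENNReal.ofReal_mul (hqr _).le, mul_add,
      Real.rpow_add hq0]
    norm_num
  have hIcc : ∀ φ : ℝ → ℝ≥0∞, ∫⁻ r in Set.Icc (0 : ℝ) 1, φ r = ∫⁻ r in Set.Ioc (0 : ℝ) 1, φ r :=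
    fun φ => by rw [Measure.restrict_congr_set Ioc_ae_eq_Icc]
  -- Information is collected over the `n` periods in `(1, 1 + n]`, entropy over the `1 + n` periods
  -- in `(0, 1 + n]`; the extra period comes from averaging the left end.
  have hIn := lintegral_Ioc_of_periodic (φ := fun r => ENNReal.ofReal (q ^ (2 * r)) *
    A.fisherInfo (q ^ r)) hIper 1 n
  have hEn := lintegral_Ioc_of_periodic (φ := fun r => A.entropy (q ^ r)) hEper 0 (1 + n)
  push_cast at hIn hEn
  simp only [zero_add] at hIn hEn
  rw [SketchIDF.avgInfo, SketchIDF.avgEntropy, hIcc, hIcc, ← hIn]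
  push_cast
  rw [← hEn]
  -- Sums and integrals are interchanged only for the measurable cell terms `e` and `j`; for the
  -- entropy and Fisher information of the sketch, monotonicity of the lower integral suffices.
  calc ENNReal.ofReal (totalRatio / Real.log 2) * ∫⁻ r in Set.Ioc (1 : ℝ) (1 + n),
        ENNReal.ofReal (q ^ (2 * r)) * A.fisherInfo (q ^ r)
      ≤ ENNReal.ofReal (totalRatio / Real.log 2) *
          ∫⁻ r in Set.Ioc (1 : ℝ) (1 + n), ∑' c, j c r := by
        gcongr with r
        exact hI r
    _ = ∑' c, ENNReal.ofReal (totalRatio / Real.log 2) *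
          ∫⁻ r in Set.Ioc (1 : ℝ) (1 + n), j c r := by
        rw [lintegral_tsum fun c => (hjm c).aemeasurable, ENNReal.tsum_mul_left]
    _ ≤ ∑' c, ((∫⁻ r in Set.Ioc (0 : ℝ) (1 + n), e c r) +
          ENNReal.ofReal ((16 + 4 * totalRatio) / Real.log q) *
          ∫⁻ r in Set.Ioc (0 : ℝ) 1, e c r) := ENNReal.tsum_le_tsum hcell
    _ = (∫⁻ r in Set.Ioc (0 : ℝ) (1 + n), ∑' c, e c r) +
          ENNReal.ofReal ((16 + 4 * totalRatio) / Real.log q) *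
          ∫⁻ r in Set.Ioc (0 : ℝ) 1, ∑' c, e c r := by
        rw [ENNReal.tsum_add, ENNReal.tsum_mul_left,
          lintegral_tsum fun c => (hem c).aemeasurable,
          lintegral_tsum fun c => (hem c).aemeasurable]
    _ ≤ _ := by
        gcongr with r r
        · exact hE r
        · exact hE r
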